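/- Let $\mathbb{T}^3=(\mathbb{R}/2\pi\mathbb{Z})^3$, and for $\sigma\in\mathbb{R}$ let $H^\sigma(\mathbb{T}^3)$ be the space of periodic distributions $f$ with $\|f\|_{H^\sigma}^2=\sum_{n\in\mathbb{Z}^3}(1+|n|^2)^{\sigma}|\widehat f(n)|^2<\infty$. Let $s\ge 0$ and $(u_0,u_1)\in H^s(\mathbb{T}^3)\times H^{s-1}(\mathbb{T}^3)$. On a probability space $(\Omega,\mathcal F,P)$ let $\{g_{j,n}\}_{j=0,1,\,n\in\mathbb{Z}^3}$ be mean-zero complex-valued random variables with $g_{j,-n}=\overline{g_{j,n}}$ almost surely, independent apart from this relation (that is, for every set $A\subset\mathbb{Z}^3$ such that $-n\notin A$ for all $n\in A\setminus\{0\}$, the family $\{g_{j,n}\}_{j=0,1,\,n\in A}$ is independent), and such that for some constant $c$ $$E\big[e^{\gamma \operatorname{Re} g_{j,n}}\big]\le e^{c\gamma^2},\qquad E\big[e^{\gamma \operatorname{Im} g_{j,n}}\big]\le e^{c\gamma^2}\qquad\text{for all }\gamma\in\mathbb{R},\ j=0,1,\ n\in\mathbb{Z}^3 .$$ Set $u_j^\omega=\sum_{n\in\mathbb{Z}^3}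 g_{j,n}(\omega)\,\widehat u_j(n)\,e^{in\cdot x}$ for $j=0,1$, and $S(t)(a,b)=\cos(t|\nabla|)a+\frac{\sin(t|\nabla|)}{|\nabla|}b$, where the symbol of $\frac{\sin(t|\nabla|)}{|\nabla|}$ at $n=0$ is $t$. Then there is a random time $T_\omega$ (a measurable function of $\omega$) such that almost surely $T_\omega>0$, $(u_0^\omega,u_1^\omega)\in H^s(\mathbb{T}^3)\times H^{s-1}(\mathbb{T}^3)$, $$S(t)(u_0^\omega,u_1^\omega)+C([0,T_\omega];H^1(\mathbb{T}^3))\subset C([0,T_\omega];L^2(\mathbb{T}^3)),$$ and there is exactly one $u$ in the class $S(t)(u_0^\omega,u_1^\omega)+C([0,T_\omega];H^1(\mathbb{T}^3))$ that solves the defocusing cubic nonlinear wave equation $$\partial_t^2u=\Delta u-u^3,\qquad (u,\partial_tu)|_{t=0}=(u_0^\omega,u_1^\omega),$$ on $[0,T_\omega]$ in the Duhamel sense: $u^3\in L^1([0,T_\omega];L^2(\mathbb{T}^3))$ and $$u(t)=S(t)(u_0^\omega,u_1^\omega)-\int_0^t\frac{\sin((t-t')|\nabla|)}{|\nabla|}\,u^3(t')\,dt',\qquad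 t\in[0,T_\omega].$$ Here functions may be complex-valued; if $u_0$ and $u_1$ are real-valued, then so is $u$. -/

import Mathlib

open MeasureTheory ProbabilityTheory Set Filter Topology
open scoped ENNReal ComplexConjugate

noncomputable section

namespace CubicNLW

/-- Frequencies `n ∈ ℤ³`. -/
abbrev Freq : Type := Fin 3 → ℤ

/-- The torus `𝕋³ = (ℝ/2πℤ)³` in the coordinate `y = x / 2π ∈ (ℝ/ℤ)³`. In this coordinate `UnitAddTorus.mFourier n` is `x ↦ e^{i n·x}`, so
that `|∇|` acts on it as multiplication by `|n|` and `-Δ` as multiplication by `|n|²`. -/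
abbrev T3 : Type := UnitAddTorus (Fin 3)

/-- The normalised Lebesgue measure `(2π)⁻³ dx` on `𝕋³`. -/
abbrev torusMeasure : Measure T3 :=
  Measure.pi fun _ : Fin 3 => (AddCircle.haarAddCircle : Measure UnitAddCircle)

/-- `L²(𝕋³)`. -/
abbrev L2 : Type := Lp ℂ 2 torusMeasure

/-- The Euclidean length `|n|` of a frequency. -/
def freqNorm (n : Freq) : ℝ := Real.sqrt (∑ i, (n i : ℝ) ^ 2)

/-- Fourier coefficients of an `L²` function. -/
def coeff (f : L2) (n : Freq) : ℂ := UnitAddTorus.mFourierCoeff (f : T3 → ℂ) n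

/-- The (extended) `H^σ(𝕋³)` norm `(∑ ⟨n⟩^{2σ} |a n|²)^{1/2}`, with `⟨n⟩ = (1 + |n|²)^{1/2}`, of
the periodic distribution with Fourier coefficients `a`. -/
def sobolevNorm (σ : ℝ) (a : Freq → ℂ) : ℝ≥0∞ :=
  (∑' n : Freq, ENNReal.ofReal ((1 + freqNorm n ^ 2) ^ σ * ‖a n‖ ^ 2)) ^ (1 / 2 : ℝ)

/-- `H^σ(𝕋³)`; a periodic distribution is given by its Fourier coefficients. -/
def Sobolev (σ : ℝ) : Set (Freq → ℂ) := {a | sobolevNorm σ a < ∞}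

/-- The symbol of `cos(t|∇|)`. -/
def cosSymbol (t : ℝ) (n : Freq) : ℝ := Real.cos (t * freqNorm n)

/-- The symbol of `sin(t|∇|)/|∇|`, equal to `t` at the zero frequency. -/
def sinSymbol (t : ℝ) (n : Freq) : ℝ :=
  if n = 0 then t else Real.sin (t * freqNorm n) / freqNorm n

/-- The `L²` function with Fourier coefficients `a` (for square summable `a`, that is, for `a` in
`Sobolev 0`). -/
def fourierSeries (a : Freq → ℂ) : L2 := ∑' n : Freq, a n • UnitAddTorus.mFourierLp 2 n

/-- The linear wave operator `S(t)(a, b) = cos(t|∇|) a + (sin(t|∇|)/|∇|) b`, for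
`(a, b) ∈ L² × H⁻¹`. -/
def linearWave (a b : Freq → ℂ) (t : ℝ) : L2 :=
  fourierSeries fun n => (cosSymbol t n : ℂ) * a n + (sinSymbol t n : ℂ) * b n

/-- The operator `sin(t|∇|)/|∇|` on `L²(𝕋³)`. -/
def sinOp (t : ℝ) (f : L2) : L2 :=
  fourierSeries fun n => (sinSymbol t n : ℂ) * coeff f n

/-- `C([0,T]; H^σ(𝕋³))`, for `L²`-valued curves (only their values on `[0,T]` matter). -/
def CSobolev (σ T : ℝ) : Set (ℝ → L2) :=
  {v | (∀ t ∈ Icc 0 T, coeff (v t) ∈ Sobolev σ) ∧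
    ∀ t₀ ∈ Icc 0 T,
      Tendsto (fun t => sobolevNorm σ (coeff (v t - v t₀))) (𝓝[Icc 0 T] t₀) (𝓝 0)}

/-- The class `S(t)(a, b) + C([0,T]; H¹(𝕋³))`. -/
def solutionClass (a b : Freq → ℂ) (T : ℝ) : Set (ℝ → L2) :=
  {u | ∃ v ∈ CSobolev 1 T, ∀ t ∈ Icc 0 T, u t = linearWave a b t + v t}

/-- `u` solves `∂ₜ²u = Δu - u³` on `[0,T]` with `(u, ∂ₜu)(0) = (a, b)`, in the Duhamel sense
`u(t) = S(t)(a, b) - ∫₀ᵗ (sin((t-t')|∇|)/|∇|) u³(t') dt'`. The curve `N` is `u³`, required to be in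
`L¹([0,T]; L²(𝕋³))`, so that the integral exists as a Bochner integral in `L²(𝕋³)`. -/
def IsSolution (a b : Freq → ℂ) (T : ℝ) (u : ℝ → L2) : Prop :=
  ∃ N : ℝ → L2,
    IntegrableOn N (Icc 0 T) ∧
    (∀ᵐ t ∂(volume.restrict (Icc 0 T)), ∀ᵐ x ∂torusMeasure, N t x = u t x ^ 3) ∧
    ∀ t ∈ Icc 0 T, u t = linearWave a b t - ∫ t' in (0 : ℝ)..t, sinOp (t - t') (N t')

/-- The periodic distribution with Fourier coefficients `a` is real-valued. -/
def IsRealDist (a : Freq → ℂ) : Prop := ∀ n, a (-n) = conj (a n)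

/-- The `L²` function `f` is real-valued. -/
def IsRealFun (f : L2) : Prop := ∀ᵐ x ∂torusMeasure, (f x).im = 0

/-- The randomising family `g j n`, `j = 0, 1`, `n ∈ ℤ³`: mean-zero complex random variables with
`g j (-n) = conj (g j n)`, independent apart from this relation (that is, independent as soon as no
two distinct frequencies are opposite), whose real and imaginary parts satisfy
`E e^{γ X} ≤ e^{c γ²}` for all real `γ`, with one constant `c`. -/
structure IsRandomizer {Ω : Type*} [MeasurableSpace Ω] (P : Measure Ω)
    (g : Fin 2 → Freq → Ω → ℂ) : Prop where
  measurable : ∀ j n, Measurable (g j n)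
  mean_zero : ∀ j n, ∫ ω, g j n ω ∂P = 0
  symm : ∀ j n, ∀ᵐ ω ∂P, g j (-n) ω = conj (g j n ω)
  indep : ∀ A : Set Freq, (∀ n ∈ A, n ≠ 0 → -n ∉ A) →
    iIndepFun (fun (p : Fin 2 × A) => g p.1 p.2) P
  exp_moment : ∃ c : ℝ, ∀ j n (γ : ℝ),
    (Integrable (fun ω => Real.exp (γ * (g j n ω).re)) P ∧
      ∫ ω, Real.exp (γ * (g j n ω).re) ∂P ≤ Real.exp (c * γ ^ 2)) ∧
    (Integrable (fun ω => Real.exp (γ * (g j n ω).im)) P ∧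
      ∫ ω, Real.exp (γ * (g j n ω).im) ∂P ≤ Real.exp (c * γ ^ 2))

/-- The randomised distribution `∑ gₙ(ω) a(n) e^{i n·x}`, through its Fourier coefficients. -/
def randomize {Ω : Type*} (g : Freq → Ω → ℂ) (a : Freq → ℂ) (ω : Ω) : Freq → ℂ :=
  fun n => g n ω * a n

end CubicNLW

end

open CubicNLW

/-!
Only the regularity `L² × H⁻¹` of the data is used. The substitution
`u = z + v` with `z = S(t)(u₀^ω, u₁^ω)` turns the cubic wave equation into one for `v ∈ C([0,T]; H¹)` whose
source is `(z + v)³`. Two facts make this equation solvable by contraction.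

*Randomisation gains integrability.* At a fixed point `(t, x)` the value `z(t, x)` is a sum of
sub-Gaussian variables with square summable weights, uniformly in `t ∈ [0, 1]` and `x`, so its sixth
moment is bounded (`IsRandomizer.eLpNorm_sum_le`; the frequencies are split into two halves without
opposite pairs, on each of which the variables are independent). Tonelli's theorem and Fatou's lemma
along partial sums give `z ∈ L⁶([0,1] × 𝕋³)` almost surely
(`IsRandomizer.ae_lintegral_waveEnvelope_lt_top`, `normL6_linearWave_le`).

*Duhamel's operator gains a derivative.* As `sin(t|∇|)/|∇|` maps `L²` to `H¹`, it is enough that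
`(z + v)³ ∈ L¹([0,T]; L²)`, which follows from `z ∈ L⁶` and the Sobolev embedding `H¹(𝕋³) ⊂ L⁶(𝕋³)`
(`normL6_invBracket_le`). The embedding is proved by computing `‖f‖₆⁶` through the distribution
function: at height `t` the frequencies `|n| ≲ t²` contribute at most `t / 2` pointwise, and
Chebyshev's inequality in `L²` is applied to the others.

Writing `v = ⟨∇⟩⁻¹ h` with `h ∈ C([0,T]; L²)`, the Duhamel formula becomes a Volterra equation in `L²`
(`isSolution_iff`) with a locally Lipschitz nonlinearity whose constant is integrable in time.
`IsVolterraNonlinearity.exists_solution` solves it as soon as the integral of the constant is small,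
which determines the measurable time `lifespan`; uniqueness among all continuous curves is Grönwall's
inequality with an integrable kernel (`IsVolterraNonlinearity.eqOn_of_solutions`). For real data the
complex conjugate of the solution is again a solution, hence equal to it.
-/

noncomputable section

namespace CubicNLW

/-! ### Fourier series in `L²` -/

/-- The orthonormal basis `e^{i n·x}` of `L²(𝕋³)`. -/
def expBasis : HilbertBasis Freq ℂ L2 := UnitAddTorus.mFourierBasis

lemma expBasis_apply (n : Freq) : expBasis n = UnitAddTorus.mFourierLp 2 n := by
  have := UnitAddTorus.coe_mFourierBasis (d := Fin 3)
  exact congrFun this n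

lemma coeff_eq_repr (f : L2) (n : Freq) : coeff f n = expBasis.repr f n :=
  (UnitAddTorus.mFourierBasis_repr f n).symm

@[simp] lemma coeff_add (f g : L2) (n : Freq) : coeff (f + g) n = coeff f n + coeff g n := by
  simp [coeff_eq_repr]

@[simp] lemma coeff_sub (f g : L2) (n : Freq) : coeff (f - g) n = coeff f n - coeff g n := by
  simp [coeff_eq_repr]

@[simp] lemma coeff_smul (c : ℂ) (f : L2) (n : Freq) : coeff (c • f) n = c * coeff f n := by
  simp [coeff_eq_repr]

lemma coeff_injective : Function.Injective coeff := by
  intro f g h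
  apply expBasis.repr.injective
  ext n
  rw [← coeff_eq_repr, ← coeff_eq_repr, h]

lemma hasSum_sq_coeff (f : L2) : HasSum (fun n => ‖coeff f n‖ ^ 2) (‖f‖ ^ 2) := by
  have h := lp.hasSum_norm (p := 2) (by norm_num) (expBasis.repr f)
  simpa [coeff_eq_repr] using h

lemma summable_sq_coeff (f : L2) : Summable fun n => ‖coeff f n‖ ^ 2 :=
  (hasSum_sq_coeff f).summable

lemma norm_sq_eq_tsum (f : L2) : ‖f‖ ^ 2 = ∑' n, ‖coeff f n‖ ^ 2 :=
  (hasSum_sq_coeff f).tsum_eq.symm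

section fourierSeries

variable {a : Freq → ℂ}

lemma exists_hasSum_fourierSeries (ha : Summable fun n => ‖a n‖ ^ 2) :
    ∃ f : L2, HasSum (fun n => a n • (UnitAddTorus.mFourierLp 2 n : L2)) f ∧ coeff f = a := by
  have hmem : Memℓp a 2 := memℓp_gen (by simpa using ha)
  refine ⟨expBasis.repr.symm ⟨a, hmem⟩, ?_, ?_⟩
  · have := expBasis.hasSum_repr_symm ⟨a, hmem⟩
    simpa [expBasis_apply] using this
  · ext n
    simp [coeff_eq_repr]

lemma hasSum_fourierSeries (ha : Summable fun n => ‖a n‖ ^ 2) :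
    HasSum (fun n => a n • (UnitAddTorus.mFourierLp 2 n : L2)) (fourierSeries a) := by
  obtain ⟨f, hf, -⟩ := exists_hasSum_fourierSeries ha
  exact hf.summable.hasSum

lemma coeff_fourierSeries (ha : Summable fun n => ‖a n‖ ^ 2) : coeff (fourierSeries a) = a := by
  obtain ⟨f, hf, h⟩ := exists_hasSum_fourierSeries ha
  rw [(hasSum_fourierSeries ha).unique hf, h]

lemma summable_sq_of_le {B : Freq → ℝ} (hB : Summable fun n => B n ^ 2) (h : ∀ n, ‖a n‖ ≤ B n) :
    Summable fun n => ‖a n‖ ^ 2 :=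
  hB.of_nonneg_of_le (fun n => by positivity)
    fun n => pow_le_pow_left₀ (norm_nonneg _) (h n) 2

/-- Dominated convergence for Fourier series in `L²`. -/
lemma tendsto_fourierSeries {ι : Type*} {l : Filter ι} {A : ι → Freq → ℂ} {B : Freq → ℝ}
    (hB : Summable fun n => B n ^ 2) (hA : ∀ᶠ i in l, ∀ n, ‖A i n‖ ≤ B n) (ha : ∀ n, ‖a n‖ ≤ B n)
    (h : ∀ n, Tendsto (fun i => A i n) l (𝓝 (a n))) :
    Tendsto (fun i => fourierSeries (A i)) l (𝓝 (fourierSeries a)) := by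
  have hs := summable_sq_of_le hB ha
  have key : Tendsto (fun i => ∑' n, ‖A i n - a n‖ ^ 2) l (𝓝 (∑' _ : Freq, (0 : ℝ))) := by
    refine tendsto_tsum_of_dominated_convergence (bound := fun n => 4 * B n ^ 2)
      (hB.mul_left 4) (fun n => ?_) ?_
    · have := ((h n).sub_const (a n)).norm.pow 2
      simpa using this
    · filter_upwards [hA] with i hi n
      have h1 : ‖A i n - a n‖ ≤ 2 * B n := by
        linarith [norm_sub_le (A i n) (a n), hi n, ha n]
      rw [Real.norm_of_nonneg (by positivity)]
      calc _ ≤ (2 * B n) ^ 2 := pow_le_pow_left₀ (norm_nonneg _) h1 2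
        _ = _ := by ring
  rw [tsum_zero] at key
  rw [tendsto_iff_norm_sub_tendsto_zero]
  have h2 : Tendsto (fun i => ‖fourierSeries (A i) - fourierSeries a‖ ^ 2) l (𝓝 0) := by
    refine key.congr' ?_
    filter_upwards [hA] with i hi
    rw [norm_sq_eq_tsum]
    simp [coeff_fourierSeries (summable_sq_of_le hB hi), coeff_fourierSeries hs]
  have h3 := h2.sqrt
  simpa [Real.sqrt_sq (norm_nonneg _)] using h3

end fourierSeries

/-! ### Fourier multipliers -/

/-- The Fourier multiplier with symbol `m`. -/
def multiplier (m : Freq → ℝ) (f : L2) : L2 := fourierSeries fun n => (m n : ℂ) * coeff f n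

lemma sinOp_eq_multiplier (t : ℝ) : sinOp t = multiplier (sinSymbol t) := rfl

section multiplier

variable {m : Freq → ℝ} {C : ℝ}

lemma norm_symbol_mul_le (hm : ∀ n, |m n| ≤ C) (f : L2) (n : Freq) :
    ‖(m n : ℂ) * coeff f n‖ ≤ C * ‖coeff f n‖ := by
  rw [norm_mul, Complex.norm_real, Real.norm_eq_abs]
  exact mul_le_mul_of_nonneg_right (hm n) (norm_nonneg _)

lemma summable_sq_const_mul_coeff (C : ℝ) (f : L2) : Summable fun n => (C * ‖coeff f n‖) ^ 2 := by
  simpa [mul_pow] using (summable_sq_coeff f).mul_left (C ^ 2)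

lemma coeff_multiplier (hm : ∀ n, |m n| ≤ C) (f : L2) (n : Freq) :
    coeff (multiplier m f) n = m n * coeff f n :=
  congrFun (coeff_fourierSeries
    (summable_sq_of_le (summable_sq_const_mul_coeff C f) (norm_symbol_mul_le hm f))) n

lemma norm_multiplier_le (hm : ∀ n, |m n| ≤ C) (f : L2) : ‖multiplier m f‖ ≤ C * ‖f‖ := by
  have hC : 0 ≤ C := (abs_nonneg _).trans (hm 0)
  refine le_of_sq_le_sq ?_ (by positivity)
  rw [norm_sq_eq_tsum, mul_pow, norm_sq_eq_tsum f, ← tsum_mul_left]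
  refine (summable_sq_coeff _).tsum_le_tsum (fun n => ?_) ((summable_sq_coeff f).mul_left _)
  rw [coeff_multiplier hm, ← mul_pow]
  exact pow_le_pow_left₀ (norm_nonneg _) (norm_symbol_mul_le hm f n) 2

lemma multiplier_sub (hm : ∀ n, |m n| ≤ C) (f g : L2) :
    multiplier m (f - g) = multiplier m f - multiplier m g := by
  apply coeff_injective
  ext n
  simp [coeff_multiplier hm, mul_sub]

/-- A family of multipliers with locally bounded symbols, continuous at each frequency, acts
jointly continuously. -/
lemma continuous_multiplier {X : Type*} [TopologicalSpace X] {m : X → Freq → ℝ} {C : X → ℝ}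
    (hC : Continuous C) (hm : ∀ t n, |m t n| ≤ C t) (hc : ∀ n, Continuous fun t => m t n) :
    Continuous fun p : X × L2 => multiplier (m p.1) p.2 := by
  rw [continuous_iff_continuousAt]
  rintro ⟨t₀, f₀⟩
  have h1 : Tendsto (fun p : X × L2 => multiplier (m p.1) f₀) (𝓝 (t₀, f₀))
      (𝓝 (multiplier (m t₀) f₀)) := by
    refine Tendsto.comp (g := fun t => multiplier (m t) f₀) ?_ continuous_fst.continuousAt
    refine tendsto_fourierSeries (B := fun n => (C t₀ + 1) * ‖coeff f₀ n‖)
      (summable_sq_const_mul_coeff _ _) ?_ ?_ ?_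
    · filter_upwards [hC.continuousAt.eventually_lt continuousAt_const (lt_add_one (C t₀))]
        with t ht n
      exact norm_symbol_mul_le (fun n => (hm t n).trans ht.le) f₀ n
    · exact norm_symbol_mul_le (fun n => (hm t₀ n).trans (lt_add_one _).le) f₀
    · intro n
      exact ((Complex.continuous_ofReal.comp (hc n)).tendsto t₀).mul_const _
  have h2 : Tendsto (fun p : X × L2 => multiplier (m p.1) (p.2 - f₀)) (𝓝 (t₀, f₀)) (𝓝 0) := by
    refine squeeze_zero_norm (a := fun p : X × L2 => C p.1 * ‖p.2 - f₀‖)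
      (fun p => norm_multiplier_le (hm p.1) _) ?_
    have : Continuous fun p : X × L2 => C p.1 * ‖p.2 - f₀‖ := by fun_prop
    simpa using this.tendsto (t₀, f₀)
  have h3 := h2.add h1
  rw [zero_add] at h3
  refine h3.congr fun p => ?_
  rw [multiplier_sub (hm p.1), sub_add_cancel]

end multiplier

/-! ### Frequencies, Sobolev norms and the wave symbols -/

lemma freqNorm_nonneg (n : Freq) : 0 ≤ freqNorm n := Real.sqrt_nonneg _

lemma freqNorm_sq (n : Freq) : freqNorm n ^ 2 = ∑ i, (n i : ℝ) ^ 2 :=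
  Real.sq_sqrt (Finset.sum_nonneg fun _ _ => sq_nonneg _)

lemma abs_le_freqNorm (n : Freq) (i : Fin 3) : |(n i : ℝ)| ≤ freqNorm n := by
  refine abs_le_of_sq_le_sq ?_ (freqNorm_nonneg n)
  rw [freqNorm_sq]
  exact Finset.single_le_sum (f := fun i => (n i : ℝ) ^ 2) (fun _ _ => sq_nonneg _)
    (Finset.mem_univ i)

lemma one_le_freqNorm {n : Freq} (hn : n ≠ 0) : 1 ≤ freqNorm n := by
  obtain ⟨i, hi⟩ := Function.ne_iff.mp hn
  refine le_trans ?_ (abs_le_freqNorm n i)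
  exact_mod_cast Int.one_le_abs hi

lemma freqNorm_neg (n : Freq) : freqNorm (-n) = freqNorm n := by simp [freqNorm]

/-- The Japanese bracket `⟨n⟩ = (1 + |n|²)^{1/2}`. -/
def bracket (n : Freq) : ℝ := Real.sqrt (1 + freqNorm n ^ 2)

lemma bracket_sq (n : Freq) : bracket n ^ 2 = 1 + freqNorm n ^ 2 := Real.sq_sqrt (by positivity)

lemma one_le_bracket (n : Freq) : 1 ≤ bracket n :=
  Real.one_le_sqrt.mpr (by nlinarith [sq_nonneg (freqNorm n)])

lemma bracket_pos (n : Freq) : 0 < bracket n := one_pos.trans_le (one_le_bracket n)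

lemma abs_inv_bracket_le (n : Freq) : |(bracket n)⁻¹| ≤ 1 := by
  rw [abs_of_nonneg (inv_nonneg.mpr (bracket_pos n).le)]
  exact inv_le_one_of_one_le₀ (one_le_bracket n)

lemma continuous_sinSymbol (n : Freq) : Continuous fun t => sinSymbol t n := by
  unfold sinSymbol
  split_ifs
  · exact continuous_id
  · fun_prop

lemma continuous_cosSymbol (n : Freq) : Continuous fun t => cosSymbol t n := by
  unfold cosSymbol
  fun_prop

lemma abs_cosSymbol_le (t : ℝ) (n : Freq) : |cosSymbol t n| ≤ 1 := Real.abs_cos_le_one _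

/-- The operator `sin(t|∇|)/|∇|` gains one derivative, away from the zero frequency uniformly in
time. -/
lemma abs_bracket_mul_sinSymbol_le (t : ℝ) (n : Freq) :
    |bracket n * sinSymbol t n| ≤ max 2 |t| := by
  unfold sinSymbol
  split_ifs with h
  · subst h
    simp [bracket, freqNorm]
  · have h1 := one_le_freqNorm h
    have h2 : bracket n ≤ 2 * freqNorm n := by
      refine Real.sqrt_le_iff.mpr ⟨by positivity, by nlinarith⟩
    refine le_max_of_le_left ?_
    rw [abs_mul, abs_div, abs_of_pos (bracket_pos n), abs_of_pos (by linarith : 0 < freqNorm n),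
      ← mul_div_assoc, div_le_iff₀ (by linarith)]
    calc _ ≤ bracket n * 1 := by
          gcongr
          · exact (bracket_pos n).le
          · exact Real.abs_sin_le_one _
      _ ≤ _ := by linarith

lemma abs_sinSymbol_le (t : ℝ) (n : Freq) : |sinSymbol t n| ≤ max 2 |t| * (bracket n)⁻¹ := by
  have := abs_bracket_mul_sinSymbol_le t n
  rw [abs_mul, abs_of_pos (bracket_pos n)] at this
  rw [← div_eq_mul_inv, le_div_iff₀ (bracket_pos n)]
  linarith

/-- The part of the Duhamel kernel acting on the `L²` level: `⟨∇⟩ sin(t|∇|)/|∇|`. -/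
def waveKernel (t : ℝ) : L2 → L2 := multiplier fun n => bracket n * sinSymbol t n

/-- The isometry `⟨∇⟩⁻¹ : L² → H¹`, regarded as an operator on `L²`. -/
def invBracket : L2 →L[ℂ] L2 :=
  LinearMap.mkContinuous
    { toFun := multiplier fun n => (bracket n)⁻¹
      map_add' := fun f g => by
        apply coeff_injective
        ext n
        simp [coeff_multiplier abs_inv_bracket_le, mul_add]
      map_smul' := fun c f => by
        apply coeff_injective
        ext n
        simp [coeff_multiplier abs_inv_bracket_le, mul_left_comm] }
    1 (norm_multiplier_le abs_inv_bracket_le)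

lemma coeff_invBracket (f : L2) (n : Freq) :
    coeff (invBracket f) n = ((bracket n)⁻¹ : ℝ) * coeff f n :=
  coeff_multiplier abs_inv_bracket_le f n

lemma invBracket_injective : Function.Injective invBracket := by
  intro f g h
  apply coeff_injective
  ext n
  have := congrArg (coeff · n) h
  simpa [coeff_invBracket, (bracket_pos n).ne'] using this

lemma sinOp_eq_invBracket (t : ℝ) (f : L2) : sinOp t f = invBracket (waveKernel t f) := by
  apply coeff_injective
  ext n
  have h : ∀ n, |sinSymbol t n| ≤ max 2 |t| := fun n =>
    (abs_sinSymbol_le t n).trans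
      (mul_le_of_le_one_right (by positivity) ((le_abs_self _).trans (abs_inv_bracket_le n)))
  have hb : (bracket n : ℂ) ≠ 0 := by exact_mod_cast (bracket_pos n).ne'
  rw [sinOp_eq_multiplier, coeff_multiplier h, coeff_invBracket, waveKernel,
    coeff_multiplier (abs_bracket_mul_sinSymbol_le t)]
  push_cast
  field_simp

lemma waveKernel_sub (t : ℝ) (f g : L2) :
    waveKernel t (f - g) = waveKernel t f - waveKernel t g :=
  multiplier_sub (abs_bracket_mul_sinSymbol_le t) f g

lemma norm_waveKernel_le {t : ℝ} (ht : |t| ≤ 2) (f : L2) : ‖waveKernel t f‖ ≤ 2 * ‖f‖ :=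
  norm_multiplier_le (fun n => (abs_bracket_mul_sinSymbol_le t n).trans_eq (max_eq_left ht)) f

lemma continuous_waveKernel : Continuous fun p : ℝ × L2 => waveKernel p.1 p.2 :=
  continuous_multiplier (m := fun t n => bracket n * sinSymbol t n) (C := fun t => max 2 |t|)
    (by fun_prop) abs_bracket_mul_sinSymbol_le fun n => (continuous_sinSymbol n).const_mul _

section Sobolev

variable {σ : ℝ} {a : Freq → ℂ}

lemma sobolev_iff_tsum :
    a ∈ Sobolev σ ↔ ∑' n, ENNReal.ofReal ((1 + freqNorm n ^ 2) ^ σ * ‖a n‖ ^ 2) < ∞ := by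
  simp only [Sobolev, mem_ofPred_eq, sobolevNorm]
  rw [ENNReal.rpow_lt_top_iff_of_pos (by norm_num)]

lemma sobolev_iff_summable :
    a ∈ Sobolev σ ↔ Summable fun n => (1 + freqNorm n ^ 2) ^ σ * ‖a n‖ ^ 2 := by
  rw [sobolev_iff_tsum]
  have h0 : ∀ n, 0 ≤ (1 + freqNorm n ^ 2) ^ σ * ‖a n‖ ^ 2 := fun n => by positivity
  refine ⟨fun h => ?_, fun h => ?_⟩
  · exact (ENNReal.summable_toReal h.ne).congr fun n => ENNReal.toReal_ofReal (h0 n)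
  · exact h.tsum_ofReal_lt_top

lemma sobolev_mono {σ τ : ℝ} (h : σ ≤ τ) : Sobolev τ ⊆ Sobolev σ := by
  intro a ha
  rw [sobolev_iff_summable] at ha ⊢
  refine ha.of_nonneg_of_le (fun n => by positivity) fun n => ?_
  gcongr
  nlinarith [sq_nonneg (freqNorm n)]

lemma sobolev_zero_iff : a ∈ Sobolev 0 ↔ Summable fun n => ‖a n‖ ^ 2 := by
  simp [sobolev_iff_summable]

lemma sobolev_neg_one_iff :
    a ∈ Sobolev (-1) ↔ Summable fun n => ((bracket n)⁻¹ * ‖a n‖) ^ 2 := by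
  rw [sobolev_iff_summable]
  refine summable_congr fun n => ?_
  rw [mul_pow, inv_pow, bracket_sq, Real.rpow_neg_one]

lemma sobolevNorm_one_eq (a : Freq → ℂ) :
    sobolevNorm 1 a = (∑' n, ENNReal.ofReal (‖(bracket n : ℂ) * a n‖ ^ 2)) ^ (1 / 2 : ℝ) := by
  simp [sobolevNorm, mul_pow, bracket_sq, abs_of_pos (bracket_pos _)]

/-- `⟨∇⟩⁻¹` maps `L²` isometrically into `H¹`. -/
lemma sobolevNorm_one_invBracket (f : L2) :
    sobolevNorm 1 (coeff (invBracket f)) = ENNReal.ofReal ‖f‖ := by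
  have hb : ∀ n, (bracket n : ℂ) ≠ 0 := fun n => by exact_mod_cast (bracket_pos n).ne'
  have : ∀ n, (bracket n : ℂ) * coeff (invBracket f) n = coeff f n := fun n => by
    rw [coeff_invBracket]
    push_cast
    rw [mul_inv_cancel_left₀ (hb n)]
  simp_rw [sobolevNorm_one_eq, this]
  rw [← ENNReal.ofReal_tsum_of_nonneg (fun _ => by positivity) (summable_sq_coeff f),
    ← norm_sq_eq_tsum, ENNReal.ofReal_rpow_of_nonneg (by positivity) (by norm_num),
    ← Real.sqrt_eq_rpow, Real.sqrt_sq (norm_nonneg f)]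

/-- `⟨∇⟩⁻¹` maps `L²` onto `H¹`. -/
lemma exists_invBracket_eq {f : L2} (hf : coeff f ∈ Sobolev 1) : ∃ h, invBracket h = f := by
  have hs : Summable fun n => ‖(bracket n : ℂ) * coeff f n‖ ^ 2 := by
    rw [sobolev_iff_summable] at hf
    simpa [mul_pow, bracket_sq, abs_of_pos (bracket_pos _)] using hf
  refine ⟨fourierSeries fun n => bracket n * coeff f n, coeff_injective ?_⟩
  ext n
  have hb : (bracket n : ℂ) ≠ 0 := by exact_mod_cast (bracket_pos n).ne'
  rw [coeff_invBracket, coeff_fourierSeries hs]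
  push_cast
  rw [inv_mul_cancel_left₀ hb]

/-- `C([0,T]; H¹)` consists of the curves `⟨∇⟩⁻¹ h` with `h` continuous into `L²`. -/
lemma mem_CSobolev_one_iff {T : ℝ} {v : ℝ → L2} :
    v ∈ CSobolev 1 T ↔
      ∃ h : ℝ → L2, ContinuousOn h (Icc 0 T) ∧ ∀ t ∈ Icc 0 T, v t = invBracket (h t) := by
  have key : ∀ h : ℝ → L2, (∀ t ∈ Icc 0 T, v t = invBracket (h t)) → ∀ t₀ ∈ Icc 0 T,
      (Tendsto (fun t => sobolevNorm 1 (coeff (v t - v t₀))) (𝓝[Icc 0 T] t₀) (𝓝 0) ↔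
        ContinuousWithinAt h (Icc 0 T) t₀) := by
    intro h hv t₀ ht₀
    have h1 : (fun t => sobolevNorm 1 (coeff (v t - v t₀))) =ᶠ[𝓝[Icc 0 T] t₀]
        fun t => edist (h t) (h t₀) := by
      filter_upwards [self_mem_nhdsWithin] with t ht
      rw [hv t ht, hv t₀ ht₀, ← map_sub, sobolevNorm_one_invBracket, edist_dist, dist_eq_norm]
    rw [tendsto_congr' h1, ContinuousWithinAt, tendsto_iff_edist_tendsto_0]
  constructor
  · rintro ⟨hv1, hv2⟩
    have : ∀ t, ∃ h : L2, t ∈ Icc 0 T → v t = invBracket h := fun t => by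
      by_cases ht : t ∈ Icc 0 T
      · obtain ⟨h, hh⟩ := exists_invBracket_eq (hv1 t ht)
        exact ⟨h, fun _ => hh.symm⟩
      · exact ⟨0, fun h => absurd h ht⟩
    choose h hh using this
    exact ⟨h, fun t₀ ht₀ => (key h hh t₀ ht₀).mp (hv2 t₀ ht₀), hh⟩
  · rintro ⟨h, hc, hh⟩
    refine ⟨fun t ht => ?_, fun t₀ ht₀ => (key h hh t₀ ht₀).mpr (hc t₀ ht₀)⟩
    rw [hh t ht, Sobolev, mem_ofPred_eq, sobolevNorm_one_invBracket]
    exact ENNReal.ofReal_lt_top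

end Sobolev

/-! ### The linear evolution -/

section linearWave

variable {a b : Freq → ℂ}

/-- The Fourier coefficients of `S(t)(a, b)`. -/
def waveCoeff (a b : Freq → ℂ) (t : ℝ) (n : Freq) : ℂ :=
  (cosSymbol t n : ℂ) * a n + (sinSymbol t n : ℂ) * b n

lemma norm_waveCoeff_le (a b : Freq → ℂ) (t : ℝ) (n : Freq) :
    ‖waveCoeff a b t n‖ ≤ ‖a n‖ + max 2 |t| * ((bracket n)⁻¹ * ‖b n‖) := by
  refine (norm_add_le _ _).trans ?_
  rw [norm_mul, norm_mul, Complex.norm_real, Complex.norm_real, Real.norm_eq_abs, Real.norm_eq_abs,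
    ← mul_assoc]
  gcongr
  · exact mul_le_of_le_one_left (norm_nonneg _) (abs_cosSymbol_le t n)
  · exact abs_sinSymbol_le t n

lemma summable_sq_waveBound (ha : a ∈ Sobolev 0) (hb : b ∈ Sobolev (-1)) (M : ℝ) :
    Summable fun n => (‖a n‖ + M * ((bracket n)⁻¹ * ‖b n‖)) ^ 2 := by
  rw [sobolev_zero_iff] at ha
  rw [sobolev_neg_one_iff] at hb
  refine ((ha.mul_left 2).add ((hb.mul_left (2 * M ^ 2)))).of_nonneg_of_le
    (fun n => by positivity) fun n => ?_
  nlinarith [sq_nonneg (‖a n‖ - M * ((bracket n)⁻¹ * ‖b n‖))]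

lemma summable_sq_waveCoeff (ha : a ∈ Sobolev 0) (hb : b ∈ Sobolev (-1)) (t : ℝ) :
    Summable fun n => ‖waveCoeff a b t n‖ ^ 2 :=
  summable_sq_of_le (summable_sq_waveBound ha hb _) (norm_waveCoeff_le a b t)

lemma coeff_linearWave (ha : a ∈ Sobolev 0) (hb : b ∈ Sobolev (-1)) (t : ℝ) :
    coeff (linearWave a b t) = waveCoeff a b t :=
  coeff_fourierSeries (summable_sq_waveCoeff ha hb t)

lemma continuous_linearWave (ha : a ∈ Sobolev 0) (hb : b ∈ Sobolev (-1)) :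
    Continuous (linearWave a b) := by
  rw [continuous_iff_continuousAt]
  intro t₀
  refine tendsto_fourierSeries
    (B := fun n => ‖a n‖ + max 2 (|t₀| + 1) * ((bracket n)⁻¹ * ‖b n‖))
    (summable_sq_waveBound ha hb _) ?_ ?_ ?_
  · filter_upwards [continuous_abs.continuousAt.eventually_lt continuousAt_const
      (lt_add_one |t₀|)] with t ht n
    refine (norm_waveCoeff_le a b t n).trans ?_
    have := (bracket_pos n).le
    gcongr
  · intro n
    refine (norm_waveCoeff_le a b t₀ n).trans ?_
    have := (bracket_pos n).le
    gcongr
    linarith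
  · intro n
    exact ((Complex.continuous_ofReal.comp (continuous_cosSymbol n)).tendsto t₀).mul_const _ |>.add
      (((Complex.continuous_ofReal.comp (continuous_sinSymbol n)).tendsto t₀).mul_const _)

/-- `S(t)(a, b) + C([0,T]; H¹)` is contained in `C([0,T]; L²)`. -/
lemma continuousOn_of_mem_solutionClass (ha : a ∈ Sobolev 0) (hb : b ∈ Sobolev (-1)) {T : ℝ}
    {u : ℝ → L2} (hu : u ∈ solutionClass a b T) : ContinuousOn u (Icc 0 T) := by
  obtain ⟨v, hv, huv⟩ := hu
  obtain ⟨h, hc, hh⟩ := mem_CSobolev_one_iff.mp hv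
  refine ((continuous_linearWave ha hb).continuousOn.add
    (invBracket.continuous.comp_continuousOn hc)).congr fun t ht => ?_
  simp [huv t ht, hh t ht]

end linearWave

/-! ### Trigonometric polynomials and partial Fourier sums -/

/-- The partial Fourier sum `∑_{n ∈ B} a n e^{i n·x}` in `L²`. -/
def partialSum (B : Finset Freq) (a : Freq → ℂ) : L2 :=
  ∑ n ∈ B, a n • UnitAddTorus.mFourierLp 2 n

lemma coeFn_partialSum (B : Finset Freq) (a : Freq → ℂ) :
    partialSum B a =ᵐ[torusMeasure] fun x => ∑ n ∈ B, a n * UnitAddTorus.mFourier n x := by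
  have h : partialSum B a = ContinuousMap.toLp (E := ℂ) 2 torusMeasure ℂ
      (∑ n ∈ B, a n • UnitAddTorus.mFourier n) := by
    rw [map_sum]
    simp only [map_smul]
    rfl
  rw [h]
  filter_upwards [ContinuousMap.coeFn_toLp (p := 2) (𝕜 := ℂ) torusMeasure
    (∑ n ∈ B, a n • UnitAddTorus.mFourier (d := Fin 3) n)] with x hx
  rw [hx]
  simp

lemma norm_mFourier_apply (n : Freq) (x : T3) : ‖UnitAddTorus.mFourier n x‖ = 1 := by
  simp [UnitAddTorus.mFourier, fourier_apply, Circle.norm_coe]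

lemma coeff_partialSum (B : Finset Freq) (a : Freq → ℂ) (n : Freq) :
    coeff (partialSum B a) n = if n ∈ B then a n else 0 := by
  set a' : Freq → ℂ := fun n => if n ∈ B then a n else 0 with ha'
  have hs : Summable fun n => ‖a' n‖ ^ 2 :=
    summable_of_ne_finset_zero (s := B) fun n hn => by simp [ha', hn]
  have h1 : HasSum (fun n => a' n • (UnitAddTorus.mFourierLp 2 n : L2)) (partialSum B a) := by
    have h2 : partialSum B a = ∑ n ∈ B, a' n • (UnitAddTorus.mFourierLp 2 n : L2) :=
      Finset.sum_congr rfl fun n hn => by simp [ha', hn]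
    rw [h2]
    exact hasSum_sum_of_ne_finset_zero fun n hn => by simp [ha', hn]
  rw [h1.unique (hasSum_fourierSeries hs), coeff_fourierSeries hs]

lemma norm_sub_partialSum_sq (B : Finset Freq) (f : L2) :
    HasSum (fun n => if n ∈ B then 0 else ‖coeff f n‖ ^ 2)
      (‖f - partialSum B (coeff f)‖ ^ 2) := by
  refine (hasSum_sq_coeff _).congr_fun fun n => ?_
  rw [coeff_sub, coeff_partialSum]
  split_ifs <;> simp

/-- The box of frequencies with `|nᵢ| < m` for all `i`; it is empty for `m = 0`. -/
def freqBox (m : ℕ) : Finset Freq := Fintype.piFinset fun _ => Finset.Ioo (-(m : ℤ)) m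

lemma mem_freqBox {m : ℕ} {n : Freq} : n ∈ freqBox m ↔ ∀ i, |n i| < m := by
  simp [freqBox, abs_lt]

lemma card_freqBox (m : ℕ) : (freqBox m).card = (2 * m - 1) ^ 3 := by
  simp only [freqBox, Fintype.card_piFinset, Int.card_Ioo, Finset.prod_const, Finset.card_univ,
    Fintype.card_fin]
  congr 1
  omega

lemma freqBox_mono : Monotone freqBox := fun m k hmk n hn => by
  rw [mem_freqBox] at hn ⊢
  exact fun i => (hn i).trans_le (by exact_mod_cast hmk)

lemma tendsto_freqBox : Tendsto freqBox atTop atTop :=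
  tendsto_atTop_finset_of_monotone freqBox_mono fun n => by
    refine ⟨∑ i, (n i).natAbs + 1, mem_freqBox.mpr fun i => ?_⟩
    have := Finset.single_le_sum (f := fun i => (n i).natAbs) (fun _ _ => Nat.zero_le _)
      (Finset.mem_univ i)
    rw [Int.abs_eq_natAbs]
    omega

lemma le_freqNorm_of_notMem_freqBox {m : ℕ} {n : Freq} (hn : n ∉ freqBox m) :
    (m : ℝ) ≤ freqNorm n := by
  rw [mem_freqBox] at hn
  push Not at hn
  obtain ⟨i, hi⟩ := hn
  refine le_trans ?_ (abs_le_freqNorm n i)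
  exact_mod_cast hi

/-- `∑_{|n| ≲ m} ⟨n⟩⁻² ≲ m`: the shell at distance `m` has `O(m²)` points. -/
lemma sum_inv_bracket_sq_le (m : ℕ) : ∑ n ∈ freqBox m, ((bracket n)⁻¹) ^ 2 ≤ 26 * m := by
  induction m with
  | zero => simp [freqBox]
  | succ m ih =>
    have hsub : freqBox m ⊆ freqBox (m + 1) := freqBox_mono (Nat.le_succ m)
    rw [← Finset.sum_sdiff hsub]
    have hcard : ((freqBox (m + 1) \ freqBox m).card : ℝ) ≤ 26 * (1 + (m : ℝ) ^ 2) := by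
      rw [Finset.card_sdiff_of_subset hsub, card_freqBox, card_freqBox]
      rcases Nat.eq_zero_or_pos m with rfl | hm
      · norm_num
      · obtain ⟨k, rfl⟩ := Nat.exists_eq_add_of_le' hm
        have h1 : 2 * (k + 1 + 1) - 1 = 2 * k + 3 := by omega
        have h2 : 2 * (k + 1) - 1 = 2 * k + 1 := by omega
        rw [h1, h2, Nat.cast_sub (Nat.pow_le_pow_left (by omega) 3)]
        push_cast
        nlinarith [sq_nonneg (k : ℝ)]
    have hterm : ∀ n ∈ freqBox (m + 1) \ freqBox m,
        ((bracket n)⁻¹) ^ 2 ≤ (1 + (m : ℝ) ^ 2)⁻¹ := by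
      intro n hn
      have := le_freqNorm_of_notMem_freqBox (Finset.mem_sdiff.mp hn).2
      rw [inv_pow, bracket_sq]
      gcongr
    have hle := Finset.sum_le_card_nsmul _ _ _ hterm
    rw [nsmul_eq_mul] at hle
    have hpos : (0 : ℝ) < 1 + (m : ℝ) ^ 2 := by positivity
    have h26 : ((freqBox (m + 1) \ freqBox m).card : ℝ) * (1 + (m : ℝ) ^ 2)⁻¹ ≤ 26 := by
      rw [← div_eq_mul_inv, div_le_iff₀ hpos]
      exact hcard
    push_cast
    linarith

/-! ### The Sobolev embedding `H¹(𝕋³) ⊂ L⁶(𝕋³)` -/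

/-- The low frequencies of an `H¹` function are bounded: `|∑_{|n| ≲ m} ⟨n⟩⁻¹ ĥ(n)| ≲ m^{1/2} ‖h‖`. -/
lemma sum_norm_coeff_invBracket_le (m : ℕ) (h : L2) :
    ∑ n ∈ freqBox m, ‖coeff (invBracket h) n‖ ≤ Real.sqrt (26 * m) * ‖h‖ := by
  have h1 : ∀ n, ‖coeff (invBracket h) n‖ = (bracket n)⁻¹ * ‖coeff h n‖ := fun n => by
    rw [coeff_invBracket, norm_mul, Complex.norm_real, Real.norm_of_nonneg]
    exact inv_nonneg.mpr (bracket_pos n).le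
  simp_rw [h1]
  refine (Real.sum_mul_le_sqrt_mul_sqrt _ _ _).trans ?_
  gcongr
  · exact sum_inv_bracket_sq_le m
  · rw [← Real.sqrt_sq (norm_nonneg h), norm_sq_eq_tsum]
    exact Real.sqrt_le_sqrt ((summable_sq_coeff h).sum_le_tsum _ fun _ _ => sq_nonneg _)

/-- The distribution function of an `H¹` function at height `t`: after removing the low
frequencies `|n| ≲ t²`, whose sum is at most `t / 2`, Chebyshev's inequality is applied to the
rest. -/
lemma measure_lt_invBracket_le {h : L2} (hh : ‖h‖ ≤ 1) {t : ℝ} (ht : 0 < t) :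
    torusMeasure {x | t < ‖(invBracket h : L2) x‖} ≤
      ∑' n, if t ^ 2 < 104 * (1 + freqNorm n)
        then ENNReal.ofReal (4 / t ^ 2 * ‖coeff (invBracket h) n‖ ^ 2) else 0 := by
  set f := invBracket h
  set m := ⌊t ^ 2 / 104⌋₊
  set B := freqBox m
  set r := f - partialSum B (coeff f) with hr
  have hm : (m : ℝ) ≤ t ^ 2 / 104 := Nat.floor_le (by positivity)
  have hm' : t ^ 2 / 104 < m + 1 := Nat.lt_floor_add_one _
  have hlow : ∑ n ∈ B, ‖coeff f n‖ ≤ t / 2 := by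
    refine (sum_norm_coeff_invBracket_le m h).trans ?_
    calc _ ≤ Real.sqrt ((t / 2) ^ 2) * 1 := by
          gcongr
          linarith
      _ = t / 2 := by rw [Real.sqrt_sq (by positivity), mul_one]
  have h1 : torusMeasure {x | t < ‖f x‖} ≤
      torusMeasure {x | ENNReal.ofReal (t / 2) ≤ ‖r x‖₊} := by
    refine measure_mono_ae ?_
    filter_upwards [coeFn_partialSum B (coeff f), Lp.coeFn_sub f (partialSum B (coeff f))]
      with x hx1 hx2 hx3
    change t < ‖f x‖ at hx3
    change ENNReal.ofReal (t / 2) ≤ ‖r x‖ₑ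
    rw [← ofReal_norm]
    refine ENNReal.ofReal_le_ofReal ?_
    have hx4 : ‖(partialSum B (coeff f)) x‖ ≤ t / 2 := by
      rw [hx1]
      refine (norm_sum_le _ _).trans (le_trans (Finset.sum_le_sum fun n _ => ?_) hlow)
      rw [norm_mul, norm_mFourier_apply, mul_one]
    rw [hr, hx2, Pi.sub_apply]
    linarith [norm_sub_norm_le (f x) ((partialSum B (coeff f)) x)]
  refine h1.trans ?_
  have h2 := Lp.meas_ge_le_mul_pow_enorm (μ := torusMeasure) r (p := 2) (by norm_num) (by norm_num)
    (ε := ENNReal.ofReal (t / 2)) (by simpa using ht)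
  refine h2.trans ?_
  have h3 : (ENNReal.ofReal (t / 2))⁻¹ ^ (2 : ℝ≥0∞).toReal * ENNReal.ofReal ‖r‖ ^ (2 : ℝ≥0∞).toReal
      = ENNReal.ofReal (4 / t ^ 2 * ‖r‖ ^ 2) := by
    rw [← ENNReal.ofReal_inv_of_pos (by positivity), ENNReal.toReal_ofNat, ENNReal.rpow_ofNat,
      ENNReal.rpow_ofNat, ← ENNReal.ofReal_pow (by positivity), ← ENNReal.ofReal_pow (by positivity),
      ← ENNReal.ofReal_mul (by positivity)]
    congr 1
    field_simp
    ring
  rw [h3]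
  have h4 := (norm_sub_partialSum_sq B f).mul_left (4 / t ^ 2)
  rw [← h4.tsum_eq, ENNReal.ofReal_tsum_of_nonneg (fun n => by split_ifs <;> positivity) h4.summable]
  refine ENNReal.tsum_le_tsum fun n => ?_
  split_ifs with hn hn2 hn2
  · simp
  · simp
  · exact le_rfl
  · exfalso
    have := le_freqNorm_of_notMem_freqBox hn
    apply hn2
    linarith

lemma lintegral_invBracket_pow_six_le {h : L2} (hh : ‖h‖ ≤ 1) :
    ∫⁻ x, ‖(invBracket h : L2) x‖ₑ ^ 6 ∂torusMeasure ≤ ENNReal.ofReal (48 * 104 ^ 2) := by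
  set f := invBracket h with hf
  have hlayer := lintegral_rpow_eq_lintegral_meas_lt_mul torusMeasure (f := fun x => ‖f x‖)
    (Eventually.of_forall fun x => norm_nonneg _)
    (Lp.aestronglyMeasurable f).norm.aemeasurable (p := 6) (by norm_num)
  have hlhs : ∫⁻ x, ‖f x‖ₑ ^ 6 ∂torusMeasure
      = ∫⁻ x, ENNReal.ofReal (‖f x‖ ^ (6 : ℝ)) ∂torusMeasure := by
    refine lintegral_congr fun x => ?_
    rw [← ofReal_norm, ← ENNReal.ofReal_pow (norm_nonneg _)]
    norm_cast
  rw [hlhs, hlayer]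
  -- the heights `t` that see the frequency `n` are those below `L n`
  set L : Freq → ℝ := fun n => Real.sqrt (104 * (1 + freqNorm n)) with hL
  have hLnn : ∀ n, 0 ≤ L n := fun n => Real.sqrt_nonneg _
  have hLsq : ∀ n, L n ^ 2 = 104 * (1 + freqNorm n) := fun n =>
    Real.sq_sqrt (by have := freqNorm_nonneg n; positivity)
  set w : Freq → ℝ := fun n => 4 * L n ^ 3 * ‖coeff f n‖ ^ 2 with hw
  have hwnn : ∀ n, 0 ≤ w n := fun n => by have := hLnn n; positivity
  have hpt : ∀ t ∈ Ioi (0 : ℝ), torusMeasure {x | t < ‖f x‖} * ENNReal.ofReal (t ^ ((6 : ℝ) - 1))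
      ≤ ∑' n, (Ioo 0 (L n)).indicator (fun _ => ENNReal.ofReal (w n)) t := by
    intro t ht
    have ht0 : (0 : ℝ) < t := ht
    have h5 : t ^ ((6 : ℝ) - 1) = t ^ 5 := by norm_num
    rw [h5]
    refine (mul_le_mul_left (measure_lt_invBracket_le hh ht0) _).trans ?_
    rw [← ENNReal.tsum_mul_right]
    refine ENNReal.tsum_le_tsum fun n => ?_
    split_ifs with hn
    · have htL : t < L n := by
        rw [← hLsq] at hn
        exact lt_of_pow_lt_pow_left₀ 2 (hLnn n) hn
      rw [indicator_of_mem (show t ∈ Ioo 0 (L n) from ⟨ht0, htL⟩),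
        ← ENNReal.ofReal_mul (by positivity)]
      refine ENNReal.ofReal_le_ofReal ?_
      calc 4 / t ^ 2 * ‖coeff (invBracket h) n‖ ^ 2 * t ^ 5
          = 4 * t ^ 3 * ‖coeff f n‖ ^ 2 := by rw [hf]; field_simp
        _ ≤ w n := by
          change _ ≤ 4 * L n ^ 3 * ‖coeff f n‖ ^ 2
          gcongr
    · simp
  refine (mul_le_mul_right (setLIntegral_mono' measurableSet_Ioi hpt) _).trans ?_
  have hint : ∫⁻ t in Ioi (0 : ℝ), ∑' n, (Ioo 0 (L n)).indicator (fun _ => ENNReal.ofReal (w n)) t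
      ≤ ENNReal.ofReal (8 * 104 ^ 2) := by
    rw [lintegral_tsum fun n =>
      (measurable_const.indicator measurableSet_Ioo).aemeasurable]
    calc _ ≤ ∑' n, ENNReal.ofReal (8 * 104 ^ 2 * ‖coeff h n‖ ^ 2) := by
          refine ENNReal.tsum_le_tsum fun n => ?_
          rw [lintegral_indicator measurableSet_Ioo, setLIntegral_const]
          refine (mul_le_mul_right (Measure.restrict_apply_le _ _) _).trans ?_
          rw [Real.volume_Ioo, sub_zero, ← ENNReal.ofReal_mul (hwnn n)]
          refine ENNReal.ofReal_le_ofReal ?_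
          have hc : ‖coeff f n‖ ^ 2 * bracket n ^ 2 = ‖coeff h n‖ ^ 2 := by
            rw [hf, coeff_invBracket, norm_mul, Complex.norm_real, Real.norm_eq_abs, mul_pow,
              sq_abs, inv_pow]
            have := (bracket_pos n).ne'
            field_simp
          rw [← hc]
          calc w n * L n = 4 * (L n ^ 2) ^ 2 * ‖coeff f n‖ ^ 2 := by rw [hw]; ring
            _ = 4 * 104 ^ 2 * ‖coeff f n‖ ^ 2 * (1 + freqNorm n) ^ 2 := by rw [hLsq]; ring
            _ ≤ 4 * 104 ^ 2 * ‖coeff f n‖ ^ 2 * (2 * bracket n ^ 2) := by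
              gcongr
              rw [bracket_sq]
              nlinarith [sq_nonneg (freqNorm n - 1)]
            _ = _ := by ring
      _ = ENNReal.ofReal (8 * 104 ^ 2 * ‖h‖ ^ 2) := by
          rw [norm_sq_eq_tsum, ← tsum_mul_left, ENNReal.ofReal_tsum_of_nonneg
            (fun _ => by positivity) ((summable_sq_coeff h).mul_left _)]
      _ ≤ _ := by
          refine ENNReal.ofReal_le_ofReal ?_
          have : ‖h‖ ^ 2 ≤ 1 := pow_le_one₀ (norm_nonneg _) hh
          linarith
  refine (mul_le_mul_right hint _).trans ?_
  rw [← ENNReal.ofReal_mul (by norm_num)]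
  exact ENNReal.ofReal_le_ofReal (by norm_num)

/-- The `L⁶(𝕋³)` norm of an `L²` function, possibly infinite. -/
def normL6 (f : L2) : ℝ≥0∞ := eLpNorm f 6 torusMeasure

lemma normL6_pow_six (f : L2) : normL6 f ^ 6 = ∫⁻ x, ‖f x‖ₑ ^ 6 ∂torusMeasure := by
  have := eLpNorm_nnreal_pow_eq_lintegral (f := f) (μ := torusMeasure) (p := 6) (by norm_num)
  simp only [NNReal.coe_ofNat, ENNReal.rpow_ofNat] at this
  exact this

lemma normL6_zero : normL6 0 = 0 := by
  rw [normL6, eLpNorm_congr_ae (Lp.coeFn_zero ℂ 2 torusMeasure), eLpNorm_zero]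

/-- The constant of the Sobolev embedding. -/
def sobolevConst : ℝ := (48 * 104 ^ 2 : ℝ) ^ (1 / 6 : ℝ)

/-- The Sobolev embedding `H¹(𝕋³) ⊂ L⁶(𝕋³)`. -/
theorem normL6_invBracket_le (h : L2) :
    normL6 (invBracket h) ≤ ENNReal.ofReal (sobolevConst * ‖h‖) := by
  have hunit : ∀ h : L2, ‖h‖ ≤ 1 → normL6 (invBracket h) ≤ ENNReal.ofReal sobolevConst := by
    intro h hh
    have h1 := lintegral_invBracket_pow_six_le hh
    rw [← normL6_pow_six] at h1
    refine (ENNReal.pow_le_pow_left_iff (n := 6) (by norm_num)).mp (h1.trans_eq ?_)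
    rw [← ENNReal.ofReal_pow (by unfold sobolevConst; positivity), sobolevConst,
      ← Real.rpow_mul_natCast (by norm_num)]
    norm_num
  rcases eq_or_ne h 0 with rfl | hne
  · simp [normL6_zero]
  · have hpos : 0 < ‖h‖ := norm_pos_iff.mpr hne
    have h1 := hunit ((‖h‖⁻¹ : ℂ) • h) (by
      rw [norm_smul, norm_inv, Complex.norm_real, norm_norm, inv_mul_cancel₀ hpos.ne'])
    have h2 : h = (‖h‖ : ℂ) • ((‖h‖⁻¹ : ℂ) • h) := by
      rw [smul_smul, mul_inv_cancel₀ (by exact_mod_cast hpos.ne'), one_smul]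
    rw [h2, map_smul, normL6, eLpNorm_congr_ae (Lp.coeFn_smul _ _), eLpNorm_const_smul, ← h2,
      mul_comm, ENNReal.ofReal_mul (by unfold sobolevConst; positivity)]
    gcongr
    · exact h1
    · rw [← ofReal_norm, Complex.norm_real, norm_norm]

/-! ### The cubic nonlinearity on `L⁶` -/

lemma norm_cube_sub_cube_le (a b : ℂ) :
    ‖a ^ 3 - b ^ 3‖ ≤ 2 * (‖a - b‖ * (‖a‖ ^ 2 + ‖b‖ ^ 2)) := by
  have h : a ^ 3 - b ^ 3 = (a - b) * (a ^ 2 + a * b + b ^ 2) := by ring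
  have h2 : ‖a ^ 2 + a * b + b ^ 2‖ ≤ ‖a‖ ^ 2 + ‖a‖ * ‖b‖ + ‖b‖ ^ 2 := by
    refine (norm_add₃_le).trans ?_
    simp [norm_pow]
  rw [h, norm_mul]
  have h3 : ‖a‖ ^ 2 + ‖a‖ * ‖b‖ + ‖b‖ ^ 2 ≤ 2 * (‖a‖ ^ 2 + ‖b‖ ^ 2) := by
    nlinarith [sq_nonneg (‖a‖ - ‖b‖), sq_nonneg ‖a‖, sq_nonneg ‖b‖]
  calc _ ≤ ‖a - b‖ * (2 * (‖a‖ ^ 2 + ‖b‖ ^ 2)) := by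
        gcongr
        exact h2.trans h3
    _ = _ := by ring

/-- The pointwise cube of a function in `L⁶`, as an element of `L²`; it is zero by convention when
the cube is not square integrable. -/
def cube (f : L2) : L2 :=
  open Classical in if h : MemLp (fun x => f x ^ 3) 2 torusMeasure then h.toLp else 0

lemma memLp_cube {f : L2} (hf : normL6 f ≠ ∞) : MemLp (fun x => f x ^ 3) 2 torusMeasure := by
  have hm := (Lp.memLp f).aestronglyMeasurable
  refine ⟨hm.pow 3, ?_⟩
  have h1 : eLpNorm (fun x => f x ^ 3) 2 torusMeasure =
      eLpNorm (fun x => ‖f x‖ ^ (3 : ℝ)) 2 torusMeasure := by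
    refine eLpNorm_congr_norm_ae (Eventually.of_forall fun x => ?_)
    norm_cast
    simp
  rw [h1, eLpNorm_norm_rpow _ (by norm_num)]
  have h2 : (2 : ℝ≥0∞) * ENNReal.ofReal 3 = 6 := by norm_num
  rw [h2]
  exact ENNReal.rpow_lt_top_of_nonneg (by norm_num) hf

lemma coeFn_cube {f : L2} (hf : normL6 f ≠ ∞) : cube f =ᵐ[torusMeasure] fun x => f x ^ 3 := by
  rw [cube, dif_pos (memLp_cube hf)]
  exact MemLp.coeFn_toLp _

lemma eq_cube_of_ae_eq {N f : L2} (h : ∀ᵐ x ∂torusMeasure, N x = f x ^ 3) : N = cube f := by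
  have hm : MemLp (fun x => f x ^ 3) 2 torusMeasure := (memLp_congr_ae h).mp (Lp.memLp N)
  rw [cube, dif_pos hm]
  exact Lp.ext (EventuallyEq.trans h hm.coeFn_toLp.symm)

lemma cube_zero : cube 0 = 0 :=
  (eq_cube_of_ae_eq (Eventually.of_forall fun x => by simp)).symm

lemma normL6_add_le (f g : L2) : normL6 (f + g) ≤ normL6 f + normL6 g := by
  rw [normL6, eLpNorm_congr_ae (Lp.coeFn_add f g)]
  exact eLpNorm_add_le (Lp.aestronglyMeasurable f) (Lp.aestronglyMeasurable g) (by norm_num)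

/-- Hölder's inequality for differences of cubes. -/
lemma norm_cube_sub_le {f g : L2} (hf : normL6 f ≠ ∞) (hg : normL6 g ≠ ∞)
    (hfg : normL6 (f - g) ≠ ∞) :
    ‖cube f - cube g‖ ≤
      2 * (normL6 (f - g)).toReal * ((normL6 f).toReal ^ 2 + (normL6 g).toReal ^ 2) := by
  have hsq : ∀ h : L2, eLpNorm (fun x => ‖h x‖ ^ 2) 3 torusMeasure = normL6 h ^ 2 := by
    intro h
    have h1 := eLpNorm_norm_rpow (p := 3) (μ := torusMeasure) (h : T3 → ℂ) (q := 2) (by norm_num)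
    have h2 : (3 : ℝ≥0∞) * ENNReal.ofReal 2 = 6 := by norm_num
    rw [h2] at h1
    simpa [normL6] using h1
  have hmf := Lp.aestronglyMeasurable f
  have hmg := Lp.aestronglyMeasurable g
  have key : eLpNorm (cube f - cube g : L2) 2 torusMeasure ≤
      ENNReal.ofReal 2 * (normL6 (f - g) * (normL6 f ^ 2 + normL6 g ^ 2)) := by
    have h1 : eLpNorm (cube f - cube g : L2) 2 torusMeasure ≤ ENNReal.ofReal 2 *
        eLpNorm (fun x => ‖(f - g : L2) x‖ * (‖f x‖ ^ 2 + ‖g x‖ ^ 2)) 2 torusMeasure := by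
      refine eLpNorm_le_mul_eLpNorm_of_ae_le_mul ?_ 2
      filter_upwards [coeFn_cube hf, coeFn_cube hg, Lp.coeFn_sub f g,
        Lp.coeFn_sub (cube f) (cube g)] with x h1 h2 h3 h4
      rw [h4, Pi.sub_apply, h1, h2, h3, Pi.sub_apply]
      refine (norm_cube_sub_cube_le _ _).trans_eq ?_
      rw [Real.norm_of_nonneg (by positivity)]
    refine h1.trans ?_
    gcongr
    have : ENNReal.HolderTriple 6 3 2 := ⟨by
      rw [← ENNReal.toReal_eq_toReal_iff' (by simp) (by simp),
        ENNReal.toReal_add (by simp) (by simp)]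
      norm_num⟩
    have h2 := eLpNorm_smul_le_mul_eLpNorm (p := 6) (q := 3) (r := 2) (μ := torusMeasure)
      (f := fun x => ‖f x‖ ^ 2 + ‖g x‖ ^ 2) (φ := fun x => ‖(f - g : L2) x‖)
      ((hmf.norm.pow 2).add (hmg.norm.pow 2)) (Lp.aestronglyMeasurable (f - g)).norm
    refine h2.trans ?_
    rw [eLpNorm_norm]
    change normL6 (f - g) * _ ≤ _
    gcongr
    refine (eLpNorm_add_le (hmf.norm.pow 2) (hmg.norm.pow 2) (by norm_num)).trans_eq ?_
    exact congrArg₂ _ (hsq f) (hsq g)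
  rw [Lp.norm_def]
  refine (ENNReal.toReal_mono ?_ key).trans_eq ?_
  · finiteness
  · rw [ENNReal.toReal_mul, ENNReal.toReal_mul, ENNReal.toReal_add (by finiteness) (by finiteness),
      ENNReal.toReal_pow, ENNReal.toReal_pow, ENNReal.toReal_ofReal (by norm_num), mul_assoc]

/-! ### Measurability of the cubic nonlinearity -/

/-- The saturation `w ↦ w / (1 + ε|w|)`, a bounded Lipschitz approximation of the identity. -/
def saturate (ε : ℝ) (w : ℂ) : ℂ := ((1 + ε * ‖w‖)⁻¹ : ℝ) * w

lemma norm_saturate {ε : ℝ} (hε : 0 < ε) (w : ℂ) : ‖saturate ε w‖ = (1 + ε * ‖w‖)⁻¹ * ‖w‖ := by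
  rw [saturate, norm_mul, Complex.norm_real, Real.norm_of_nonneg (by positivity)]

lemma norm_saturate_le {ε : ℝ} (hε : 0 < ε) (w : ℂ) : ‖saturate ε w‖ ≤ ‖w‖ := by
  rw [norm_saturate hε]
  refine mul_le_of_le_one_left (norm_nonneg _) (inv_le_one_of_one_le₀ ?_)
  have : 0 ≤ ε * ‖w‖ := by positivity
  linarith

lemma norm_saturate_le_inv {ε : ℝ} (hε : 0 < ε) (w : ℂ) : ‖saturate ε w‖ ≤ ε⁻¹ := by
  have : 0 ≤ ε * ‖w‖ := by positivity
  rw [norm_saturate hε, inv_mul_le_iff₀ (by positivity)]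
  have h : (1 + ε * ‖w‖) * ε⁻¹ = ε⁻¹ + ‖w‖ := by field_simp
  rw [h]
  have : 0 < ε⁻¹ := by positivity
  linarith

lemma norm_saturate_sub_le {ε : ℝ} (hε : 0 < ε) (a b : ℂ) :
    ‖saturate ε a - saturate ε b‖ ≤ 2 * ‖a - b‖ := by
  have ha : 0 < 1 + ε * ‖a‖ := by positivity
  have hb : 0 < 1 + ε * ‖b‖ := by positivity
  have hac : ((1 + ε * ‖a‖ : ℝ) : ℂ) ≠ 0 := by exact_mod_cast ha.ne'
  have hbc : ((1 + ε * ‖b‖ : ℝ) : ℂ) ≠ 0 := by exact_mod_cast hb.ne'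
  have h1 : saturate ε a - saturate ε b = ((1 + ε * ‖a‖)⁻¹ : ℝ) * ((a - b) +
      ((ε * (‖b‖ - ‖a‖) : ℝ) : ℂ) * saturate ε b) := by
    unfold saturate
    push_cast at hac hbc ⊢
    field_simp
    ring
  have h2 : ‖((ε * (‖b‖ - ‖a‖) : ℝ) : ℂ) * saturate ε b‖ ≤ ‖a - b‖ := by
    rw [norm_mul, Complex.norm_real, norm_mul, Real.norm_of_nonneg hε.le, Real.norm_eq_abs]
    calc ε * |‖b‖ - ‖a‖| * ‖saturate ε b‖ ≤ ε * ‖b - a‖ * ε⁻¹ := by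
          gcongr
          · exact abs_norm_sub_norm_le b a
          · exact norm_saturate_le_inv hε b
      _ = ‖a - b‖ := by rw [norm_sub_rev]; field_simp
  rw [h1, norm_mul, Complex.norm_real, Real.norm_of_nonneg (by positivity)]
  calc _ ≤ 1 * (‖a - b‖ + ‖a - b‖) := by
        gcongr
        · refine inv_le_one_of_one_le₀ ?_
          have : 0 ≤ ε * ‖a‖ := by positivity
          linarith
        · exact (norm_add_le _ _).trans (by gcongr)
    _ = _ := by ring

lemma lipschitzWith_saturate_cube {ε : ℝ} (hε : 0 < ε) :
    LipschitzWith (Real.toNNReal (8 * ε⁻¹ ^ 2)) fun w => saturate ε w ^ 3 := by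
  refine LipschitzWith.of_dist_le_mul fun a b => ?_
  rw [Real.coe_toNNReal _ (by positivity), dist_eq_norm, dist_eq_norm]
  refine (norm_cube_sub_cube_le _ _).trans ?_
  calc _ ≤ 2 * (2 * ‖a - b‖ * (ε⁻¹ ^ 2 + ε⁻¹ ^ 2)) := by
        gcongr
        · exact norm_saturate_sub_le hε a b
        · exact norm_saturate_le_inv hε a
        · exact norm_saturate_le_inv hε b
    _ = _ := by ring

lemma tendsto_saturate (w : ℂ) :
    Tendsto (fun k : ℕ => saturate (1 / ((k : ℝ) + 1)) w) atTop (𝓝 w) := by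
  have h1 : Tendsto (fun k : ℕ => (1 + 1 / ((k : ℝ) + 1) * ‖w‖)⁻¹) atTop (𝓝 (1 + 0 * ‖w‖)⁻¹) :=
    ((tendsto_one_div_add_atTop_nhds_zero_nat.mul_const _).const_add 1).inv₀ (by simp)
  have h2 := ((Complex.continuous_ofReal.tendsto _).comp h1).mul_const w
  simpa [saturate] using h2

/-- The cube of the saturation, a Lipschitz map on `L²` approximating `cube`. -/
def saturatedCube (ε : ℝ) (hε : 0 < ε) (f : L2) : L2 :=
  (lipschitzWith_saturate_cube hε).compLp (by simp [saturate]) f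

lemma tendsto_saturatedCube {f : L2} (hf : normL6 f ≠ ∞) :
    Tendsto (fun k : ℕ => saturatedCube (1 / ((k : ℝ) + 1)) (by positivity) f) atTop
      (𝓝 (cube f)) := by
  rw [Lp.tendsto_Lp_iff_tendsto_eLpNorm']
  have hcoe : ∀ᵐ x ∂torusMeasure, ∀ k : ℕ,
      (saturatedCube (1 / ((k : ℝ) + 1)) (by positivity) f) x =
        saturate (1 / ((k : ℝ) + 1)) (f x) ^ 3 := by
    rw [ae_all_iff]
    intro k
    exact LipschitzWith.coeFn_compLp _ _ _
  have hsq : ∀ h : T3 → ℂ, eLpNorm h 2 torusMeasure =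
      (∫⁻ x, ‖h x‖ₑ ^ (2 : ℝ) ∂torusMeasure) ^ (1 / 2 : ℝ) := fun h => by
    rw [eLpNorm_eq_lintegral_rpow_enorm_toReal (by norm_num) (by norm_num)]
    simp
  simp_rw [hsq]
  have hzero : (0 : ℝ≥0∞) = (∫⁻ _ : T3, 0 ∂torusMeasure) ^ (1 / 2 : ℝ) := by simp
  rw [hzero]
  refine Tendsto.ennrpow_const _ ?_
  refine tendsto_lintegral_of_dominated_convergence' (fun x => (2 * ‖f x ^ 3‖ₑ) ^ (2 : ℝ)) ?_ ?_ ?_ ?_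
  · intro k
    exact ((Lp.aestronglyMeasurable _).sub (Lp.aestronglyMeasurable _)).enorm.pow_const _
  · intro k
    filter_upwards [hcoe, coeFn_cube hf] with x hx1 hx2
    rw [Pi.sub_apply, hx1 k, hx2]
    gcongr
    rw [two_mul]
    refine (enorm_sub_le).trans ?_
    gcongr
    rw [enorm_le_iff_norm_le, norm_pow, norm_pow]
    gcongr
    exact norm_saturate_le (by positivity) _
  · have h1 := (memLp_cube hf).const_mul 2
    have h2 := h1.2
    rw [hsq, ENNReal.rpow_lt_top_iff_of_pos (by norm_num)] at h2
    have h3 : ‖(2 : ℂ)‖ₑ = 2 := by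
      rw [← ofReal_norm]
      simp
    simpa [enorm_mul, h3] using h2.ne
  · filter_upwards [hcoe, coeFn_cube hf] with x hx1 hx2
    have h1 : Tendsto (fun k : ℕ => ‖saturate (1 / ((k : ℝ) + 1)) (f x) ^ 3 - f x ^ 3‖ₑ ^ (2 : ℝ))
        atTop (𝓝 (‖f x ^ 3 - f x ^ 3‖ₑ ^ (2 : ℝ))) :=
      ((((tendsto_saturate (f x)).pow 3).sub_const _).enorm).ennrpow_const _
    rw [sub_self, enorm_zero, ENNReal.zero_rpow_of_pos (by norm_num)] at h1
    refine h1.congr fun k => ?_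
    rw [Pi.sub_apply, hx1 k, hx2]

lemma aestronglyMeasurable_cube {μ : Measure ℝ} {u : ℝ → L2} (hu : AEStronglyMeasurable u μ)
    (h6 : ∀ᵐ t ∂μ, normL6 (u t) ≠ ∞) : AEStronglyMeasurable (fun t => cube (u t)) μ := by
  refine aestronglyMeasurable_of_tendsto_ae atTop
    (f := fun (k : ℕ) t => saturatedCube (1 / ((k : ℝ) + 1)) (by positivity) (u t)) (fun k => ?_) ?_
  · exact (LipschitzWith.continuous_compLp _ _).comp_aestronglyMeasurable hu
  · filter_upwards [h6] with t ht
    exact tendsto_saturatedCube ht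

/-! ### A Grönwall inequality with an integrable kernel -/

/-- Grönwall's inequality in the homogeneous case, with a merely integrable kernel. -/
lemma eq_zero_of_le_integral_mul {T : ℝ} {b d : ℝ → ℝ} (hb : IntegrableOn b (Icc 0 T))
    (hb0 : ∀ᵐ t ∂volume.restrict (Icc 0 T), 0 ≤ b t) (hd : ContinuousOn d (Icc 0 T))
    (hd0 : ∀ t ∈ Icc 0 T, 0 ≤ d t)
    (hle : ∀ t ∈ Icc 0 T, d t ≤ ∫ s in (0 : ℝ)..t, b s * d s) : ∀ t ∈ Icc 0 T, d t = 0 := by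
  rcases lt_or_ge T 0 with hT | hT
  · intro t ht
    linarith [ht.1, ht.2]
  have hbd : IntegrableOn (fun s => b s * d s) (Icc 0 T) := hb.mul_continuousOn hd isCompact_Icc
  have hbd0 : ∀ᵐ t ∂volume.restrict (Icc 0 T), 0 ≤ b t * d t := by
    filter_upwards [hb0, ae_restrict_mem measurableSet_Icc] with t h1 h2
    exact mul_nonneg h1 (hd0 t h2)
  have hsub : ∀ {x y}, x ∈ Icc 0 T → y ∈ Icc 0 T → x ≤ y → Ioc x y ⊆ Icc 0 T :=
    fun hx hy _ z hz => ⟨hx.1.trans hz.1.le, hz.2.trans hy.2⟩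
  have hii : ∀ {f : ℝ → ℝ}, IntegrableOn f (Icc 0 T) → ∀ {x y}, x ∈ Icc 0 T → y ∈ Icc 0 T →
      IntervalIntegrable f volume x y := fun hf x y hx hy =>
    (hf.mono_set (uIcc_subset_Icc hx hy)).intervalIntegrable
  have h0T : (0 : ℝ) ∈ Icc 0 T := ⟨le_rfl, hT⟩
  set G : ℝ → ℝ := fun t => ∫ s in (0 : ℝ)..t, b s * d s with hG
  have hGadd : ∀ x ∈ Icc 0 T, ∀ y ∈ Icc 0 T, G y = G x + ∫ s in x..y, b s * d s :=
    fun x hx y hy => (intervalIntegral.integral_add_adjacent_intervals (hii hbd h0T hx)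
      (hii hbd hx hy)).symm
  have hnn : ∀ {f : ℝ → ℝ}, (∀ᵐ t ∂volume.restrict (Icc 0 T), 0 ≤ f t) → ∀ x ∈ Icc 0 T,
      ∀ y ∈ Icc 0 T, x ≤ y → 0 ≤ ∫ s in x..y, f s := fun hf x hx y hy hxy => by
    refine intervalIntegral.integral_nonneg_of_ae_restrict hxy ?_
    exact ae_mono (Measure.restrict_mono (Icc_subset_Icc hx.1 hy.2) le_rfl) hf
  have hGc : ContinuousOn G (Icc 0 T) := intervalIntegral.continuousOn_primitive_interval
    (by rwa [uIcc_of_le hT]) |>.mono (by rw [uIcc_of_le hT])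
  have hbc : ContinuousOn (fun t => ∫ s in (0 : ℝ)..t, b s) (Icc 0 T) :=
    intervalIntegral.continuousOn_primitive_interval
      (by rwa [uIcc_of_le hT]) |>.mono (by rw [uIcc_of_le hT])
  suffices hkey : Icc 0 T ⊆ {t | G t = 0} from fun t ht =>
    le_antisymm ((hle t ht).trans_eq (hkey ht)) (hd0 t ht)
  refine IsClosed.Icc_subset_of_forall_exists_gt ?_ (by simp [hG]) ?_
  · rw [inter_comm]
    exact hGc.preimage_isClosed_of_isClosed isClosed_Icc isClosed_singleton
  rintro x ⟨hx0, hx⟩ y hy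
  have hx0 : G x = 0 := hx0
  have hxI : x ∈ Icc 0 T := ⟨hx.1, hx.2.le⟩
  -- on a short interval to the right of `x` the kernel has mass at most `1 / 2`
  obtain ⟨z, hz, hzb⟩ : ∃ z ∈ Ioc x (min y T), ∫ s in x..z, b s ≤ 1 / 2 := by
    have h1 : Tendsto (fun t => ∫ s in x..t, b s) (𝓝[Icc 0 T] x) (𝓝 0) := by
      have h2 := (hbc x hxI).tendsto.sub_const (∫ s in (0 : ℝ)..x, b s)
      rw [sub_self] at h2
      refine h2.congr' ?_
      filter_upwards [self_mem_nhdsWithin] with t ht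
      rw [intervalIntegral.integral_interval_sub_left (hii hb h0T ht) (hii hb h0T hxI)]
    have h3 : 𝓝[Ioc x (min y T)] x ≤ 𝓝[Icc 0 T] x :=
      nhdsWithin_mono x fun t ht => ⟨hx.1.trans ht.1.le, ht.2.trans (min_le_right _ _)⟩
    have h4 : (𝓝[Ioc x (min y T)] x).NeBot := by
      rw [nhdsWithin_Ioc_eq_nhdsGT (lt_min hy hx.2)]
      infer_instance
    have h5 := (h1.mono_left h3).eventually (ge_mem_nhds (by norm_num : (0 : ℝ) < 1 / 2))
    obtain ⟨z, hz1, hz2⟩ := (h5.and self_mem_nhdsWithin).exists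
    exact ⟨z, hz2, hz1⟩
  have hzI : z ∈ Icc 0 T := ⟨hx.1.trans hz.1.le, hz.2.trans (min_le_right _ _)⟩
  refine ⟨z, ?_, hz.1, hz.2.trans (min_le_left _ _)⟩
  have hxz : Icc x z ⊆ Icc 0 T := Icc_subset_Icc hx.1 hzI.2
  obtain ⟨τ, hτ, hmax⟩ := isCompact_Icc.exists_isMaxOn (nonempty_Icc.mpr hz.1.le) (hd.mono hxz)
  have hτI := hxz hτ
  have hbound : ∀ w ∈ Icc x z, ∫ s in x..w, b s * d s ≤ 1 / 2 * d τ := by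
    intro w hw
    have hwI := hxz hw
    calc ∫ s in x..w, b s * d s ≤ ∫ s in x..w, b s * d τ := by
          refine intervalIntegral.integral_mono_ae_restrict hw.1 (hii hbd hxI hwI)
            ((hii hb hxI hwI).mul_const _) ?_
          filter_upwards [ae_mono (Measure.restrict_mono (Icc_subset_Icc hx.1 hwI.2) le_rfl) hb0,
            ae_restrict_mem measurableSet_Icc] with s hs1 hs2
          exact mul_le_mul_of_nonneg_left (hmax ⟨hs2.1, hs2.2.trans hw.2⟩) hs1
      _ = (∫ s in x..w, b s) * d τ := intervalIntegral.integral_mul_const _ _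
      _ ≤ 1 / 2 * d τ := by
          refine mul_le_mul_of_nonneg_right ?_ (hd0 τ hτI)
          have h1 := intervalIntegral.integral_add_adjacent_intervals (hii hb hxI hwI)
            (hii hb hwI hzI)
          have h2 := hnn hb0 w hwI z hzI hw.2
          linarith
  have hdτ : d τ ≤ 0 := by
    have h1 := hle τ hτI
    have h2 := hGadd x hxI τ hτI
    have h3 := hbound τ hτ
    have h4 : d τ ≤ G τ := h1
    linarith
  have h1 := hGadd x hxI z hzI
  have h2 := hbound z ⟨hz.1.le, le_rfl⟩
  have h3 := hnn hbd0 x hxI z hzI hz.1.le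
  have h4 := hd0 τ hτI
  change G z = 0
  linarith

/-! ### Volterra equations with an integrable, locally Lipschitz nonlinearity -/

section Volterra

variable {E : Type*} [NormedAddCommGroup E]

/-- A strongly continuous family of additive operators, bounded by `2` on `[0, 1]`. -/
structure IsVolterraKernel (K : ℝ → E → E) : Prop where
  continuous : Continuous fun p : ℝ × E => K p.1 p.2
  map_sub : ∀ t f g, K t (f - g) = K t f - K t g
  norm_le : ∀ t ∈ Icc (0 : ℝ) 1, ∀ f, ‖K t f‖ ≤ 2 * ‖f‖

/-- A nonlinearity that maps continuous curves to measurable ones and is locally Lipschitz with a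
constant that is integrable in time. -/
structure IsVolterraNonlinearity (T : ℝ) (a : ℝ → ℝ) (F : ℝ → E → E) : Prop where
  measurable : ∀ h : ℝ → E, ContinuousOn h (Icc 0 T) →
    AEStronglyMeasurable (fun t => F t (h t)) (volume.restrict (Icc 0 T))
  integrable : IntegrableOn a (Icc 0 T)
  zero_le : ∀ᵐ t ∂volume.restrict (Icc 0 T), ‖F t 0‖ ≤ a t
  lipschitz : ∀ᵐ t ∂volume.restrict (Icc 0 T), ∀ h k : E,
    ‖F t h - F t k‖ ≤ a t * (1 + ‖h‖ ^ 2 + ‖k‖ ^ 2) * ‖h - k‖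

variable {K : ℝ → E → E} {T : ℝ} {a : ℝ → ℝ} {F : ℝ → E → E}

lemma IsVolterraNonlinearity.nonneg (hF : IsVolterraNonlinearity T a F) :
    ∀ᵐ t ∂volume.restrict (Icc 0 T), 0 ≤ a t :=
  hF.zero_le.mono fun _ h => (norm_nonneg _).trans h

lemma IsVolterraKernel.aestronglyMeasurable (hK : IsVolterraKernel K) {N : ℝ → E} {μ : Measure ℝ}
    (hN : AEStronglyMeasurable N μ) (t : ℝ) :
    AEStronglyMeasurable (fun s => K (t - s) (N s)) μ :=
  hK.continuous.comp_aestronglyMeasurable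
    ((continuous_const.sub continuous_id).aestronglyMeasurable.prodMk hN)

lemma IsVolterraKernel.intervalIntegrable (hK : IsVolterraKernel K) (hT : T ≤ 1) {N : ℝ → E}
    (hN : IntegrableOn N (Icc 0 T)) {t : ℝ} (ht : t ∈ Icc 0 T) :
    IntervalIntegrable (fun s => K (t - s) (N s)) volume 0 t := by
  rw [intervalIntegrable_iff_integrableOn_Ioc_of_le ht.1]
  have hN' : IntegrableOn N (Ioc 0 t) :=
    hN.mono_set (Ioc_subset_Icc_self.trans (Icc_subset_Icc le_rfl ht.2))
  refine Integrable.mono' (hN'.norm.const_mul 2) (hK.aestronglyMeasurable hN'.1 t) ?_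
  filter_upwards [ae_restrict_mem measurableSet_Ioc] with s hs
  exact hK.norm_le _ ⟨by linarith [hs.2], by linarith [hs.1, ht.2]⟩ _

lemma IsVolterraKernel.norm_integral_le [NormedSpace ℝ E] (hK : IsVolterraKernel K) (hT : T ≤ 1) {N : ℝ → E}
    {a : ℝ → ℝ} (ha : IntegrableOn a (Icc 0 T))
    (hNa : ∀ᵐ t ∂volume.restrict (Icc 0 T), ‖N t‖ ≤ a t) {t : ℝ} (ht : t ∈ Icc 0 T) :
    ‖∫ s in (0 : ℝ)..t, K (t - s) (N s)‖ ≤ 2 * ∫ s in (0 : ℝ)..t, a s := by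
  have hsub : Icc 0 t ⊆ Icc 0 T := Icc_subset_Icc le_rfl ht.2
  rw [← intervalIntegral.integral_const_mul]
  refine intervalIntegral.norm_integral_le_of_norm_le ht.1 ?_ ?_
  · have h1 := (ae_restrict_iff' measurableSet_Icc).mp hNa
    filter_upwards [h1] with s hs hs'
    refine (hK.norm_le _ ⟨by linarith [hs'.2], by linarith [hs'.1, ht.2]⟩ _).trans ?_
    linarith [hs (hsub (Ioc_subset_Icc_self hs'))]
  · refine IntervalIntegrable.const_mul ?_ 2
    exact ((ha.mono_set hsub).mono_set (uIcc_of_le ht.1).le).intervalIntegrable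

/-- Duhamel integrals of integrable sources are continuous in time. -/
lemma IsVolterraKernel.continuousOn_integral [NormedSpace ℝ E] (hK : IsVolterraKernel K) (hT : T ≤ 1) {N : ℝ → E}
    (hN : IntegrableOn N (Icc 0 T)) :
    ContinuousOn (fun t => ∫ s in (0 : ℝ)..t, K (t - s) (N s)) (Icc 0 T) := by
  intro t₀ ht₀
  have heq : ∀ t ∈ Icc 0 T, ∫ s in (0 : ℝ)..t, K (t - s) (N s) =
      ∫ s in Icc 0 T, (Ioc 0 t).indicator (fun s => K (t - s) (N s)) s := by
    intro t ht
    have hsub : Ioc 0 t ⊆ Icc 0 T := Ioc_subset_Icc_self.trans (Icc_subset_Icc le_rfl ht.2)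
    rw [intervalIntegral.integral_of_le ht.1, integral_indicator measurableSet_Ioc,
      Measure.restrict_restrict measurableSet_Ioc, inter_eq_left.mpr hsub]
  have hmain : ContinuousWithinAt (fun t => ∫ s in Icc 0 T,
      (Ioc 0 t).indicator (fun s => K (t - s) (N s)) s) (Icc 0 T) t₀ := by
    refine continuousWithinAt_of_dominated (bound := fun s => 2 * ‖N s‖) ?_ ?_
      (hN.norm.const_mul 2) ?_
    · exact Eventually.of_forall fun t => (hK.aestronglyMeasurable hN.1 t).indicator
        measurableSet_Ioc
    · filter_upwards [self_mem_nhdsWithin] with t ht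
      refine Eventually.of_forall fun s => ?_
      by_cases hs : s ∈ Ioc 0 t
      · rw [indicator_of_mem hs]
        exact hK.norm_le _ ⟨by linarith [hs.2], by linarith [hs.1, ht.2]⟩ _
      · rw [indicator_of_notMem hs, norm_zero]
        positivity
    · have hne : ∀ᵐ s ∂volume.restrict (Icc 0 T), s ≠ t₀ :=
        ae_restrict_of_ae (Measure.ae_ne volume t₀)
      have hne0 : ∀ᵐ s ∂volume.restrict (Icc 0 T), s ≠ 0 :=
        ae_restrict_of_ae (Measure.ae_ne volume 0)
      filter_upwards [hne, hne0, ae_restrict_mem measurableSet_Icc] with s hs hs0 hsI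
      have hs0' : 0 < s := lt_of_le_of_ne hsI.1 (Ne.symm hs0)
      refine ContinuousAt.continuousWithinAt ?_
      rcases lt_or_gt_of_ne hs with hlt | hgt
      · have hc : ContinuousAt (fun t => K (t - s) (N s)) t₀ :=
          (hK.continuous.comp ((continuous_id.sub continuous_const).prodMk
            continuous_const)).continuousAt
        refine hc.congr ?_
        filter_upwards [lt_mem_nhds hlt] with t ht
        rw [indicator_of_mem (show s ∈ Ioc 0 t from ⟨hs0', ht.le⟩)]
      · refine (continuousAt_const (y := (0 : E))).congr ?_
        filter_upwards [gt_mem_nhds hgt] with t ht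
        rw [indicator_of_notMem fun h : s ∈ Ioc 0 t => not_lt.mpr h.2 ht]
  exact hmain.congr heq (heq t₀ ht₀)

namespace IsVolterraNonlinearity

lemma norm_le (hF : IsVolterraNonlinearity T a F) {h : ℝ → E} {R : ℝ}
    (hR : ∀ t ∈ Icc 0 T, ‖h t‖ ≤ R) :
    ∀ᵐ t ∂volume.restrict (Icc 0 T), ‖F t (h t)‖ ≤ a t * (1 + (1 + R ^ 2) * R) := by
  filter_upwards [hF.nonneg, hF.zero_le, hF.lipschitz, ae_restrict_mem measurableSet_Icc]
    with t h0 h1 h2 ht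
  have h3 := h2 (h t) 0
  rw [sub_zero, norm_zero] at h3
  have h4 : ‖F t (h t)‖ ≤ ‖F t (h t) - F t 0‖ + ‖F t 0‖ := by
    simpa using norm_add_le (F t (h t) - F t 0) (F t 0)
  have h5 : a t * (1 + ‖h t‖ ^ 2 + 0 ^ 2) * ‖h t‖ ≤ a t * (1 + R ^ 2) * R := by
    have := hR t ht
    rw [zero_pow (by norm_num), add_zero]
    gcongr
  linarith

lemma integrableOn (hF : IsVolterraNonlinearity T a F) {h : ℝ → E}
    (hh : ContinuousOn h (Icc 0 T)) : IntegrableOn (fun t => F t (h t)) (Icc 0 T) := by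
  obtain ⟨R, hR⟩ := isCompact_Icc.exists_bound_of_continuousOn hh
  exact Integrable.mono' (hF.integrable.mul_const _) (hF.measurable h hh) (hF.norm_le hR)

lemma norm_integral_sub_le [NormedSpace ℝ E] (hF : IsVolterraNonlinearity T a F) (hK : IsVolterraKernel K)
    (hT : T ≤ 1) {h k : ℝ → E} (hh : ContinuousOn h (Icc 0 T)) (hk : ContinuousOn k (Icc 0 T))
    {R : ℝ} (hhR : ∀ t ∈ Icc 0 T, ‖h t‖ ≤ R) (hkR : ∀ t ∈ Icc 0 T, ‖k t‖ ≤ R)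
    {t : ℝ} (ht : t ∈ Icc 0 T) :
    ‖(∫ s in (0 : ℝ)..t, K (t - s) (F s (h s))) - ∫ s in (0 : ℝ)..t, K (t - s) (F s (k s))‖ ≤
      2 * ∫ s in (0 : ℝ)..t, a s * (1 + R ^ 2 + R ^ 2) * ‖h s - k s‖ := by
  rw [← intervalIntegral.integral_sub (hK.intervalIntegrable hT (hF.integrableOn hh) ht)
    (hK.intervalIntegrable hT (hF.integrableOn hk) ht)]
  simp_rw [← hK.map_sub]
  refine hK.norm_integral_le hT
    (IntegrableOn.mul_continuousOn (hF.integrable.mul_const _) (hh.sub hk).norm isCompact_Icc) ?_ ht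
  filter_upwards [hF.nonneg, hF.lipschitz, ae_restrict_mem measurableSet_Icc] with s h0 h1 hs
  refine (h1 (h s) (k s)).trans ?_
  have := hhR s hs
  have := hkR s hs
  gcongr
  exact le_rfl

/-- Solutions of the Volterra equation are unique among continuous curves. -/
theorem eqOn_of_solutions [NormedSpace ℝ E] (hF : IsVolterraNonlinearity T a F) (hK : IsVolterraKernel K)
    (hT : T ≤ 1) {h k : ℝ → E} (hh : ContinuousOn h (Icc 0 T)) (hk : ContinuousOn k (Icc 0 T))
    (hhe : ∀ t ∈ Icc 0 T, h t = -∫ s in (0 : ℝ)..t, K (t - s) (F s (h s)))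
    (hke : ∀ t ∈ Icc 0 T, k t = -∫ s in (0 : ℝ)..t, K (t - s) (F s (k s))) :
    EqOn h k (Icc 0 T) := by
  obtain ⟨R₁, hR₁⟩ := isCompact_Icc.exists_bound_of_continuousOn hh
  obtain ⟨R₂, hR₂⟩ := isCompact_Icc.exists_bound_of_continuousOn hk
  set R := max R₁ R₂
  have hd : ∀ t ∈ Icc 0 T, ‖h t - k t‖ = 0 := by
    refine eq_zero_of_le_integral_mul (b := fun s => 2 * (a s * (1 + R ^ 2 + R ^ 2)))
      ((hF.integrable.mul_const _).const_mul 2) ?_ (hh.sub hk).norm (fun _ _ => norm_nonneg _) ?_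
    · filter_upwards [hF.nonneg] with t ht
      positivity
    · intro t ht
      have h1 := hF.norm_integral_sub_le hK hT hh hk (R := R)
        (fun s hs => (hR₁ s hs).trans (le_max_left _ _))
        (fun s hs => (hR₂ s hs).trans (le_max_right _ _)) ht
      rw [← intervalIntegral.integral_const_mul] at h1
      simp_rw [mul_assoc] at h1 ⊢
      refine le_trans (le_of_eq ?_) h1
      rw [hhe t ht, hke t ht, ← norm_neg]
      congr 1
      abel
  intro t ht
  exact sub_eq_zero.mp (norm_eq_zero.mp (hd t ht))

/-- If the Lipschitz constant has small integral, then the Volterra equation has a continuous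
solution: the solution map contracts the unit ball of `C([0,T]; E)`. -/
theorem exists_solution [NormedSpace ℝ E] [CompleteSpace E] (hF : IsVolterraNonlinearity T a F)
    (hK : IsVolterraKernel K) (hT0 : 0 ≤ T) (hT : T ≤ 1) (hsmall : ∫ t in Icc 0 T, a t ≤ 1 / 12) :
    ∃ h : ℝ → E, ContinuousOn h (Icc 0 T) ∧
      ∀ t ∈ Icc 0 T, h t = -∫ s in (0 : ℝ)..t, K (t - s) (F s (h s)) := by
  have hsmall' : ∀ t ∈ Icc 0 T, ∫ s in (0 : ℝ)..t, a s ≤ 1 / 12 := by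
    intro t ht
    rw [intervalIntegral.integral_of_le ht.1]
    refine (setIntegral_mono_set hF.integrable hF.nonneg ?_).trans hsmall
    exact (Ioc_subset_Icc_self.trans (Icc_subset_Icc le_rfl ht.2)).eventuallyLE
  let ext : C(Icc 0 T, E) → ℝ → E := fun f => IccExtend hT0 f
  have hextc : ∀ f, ContinuousOn (ext f) (Icc 0 T) := fun f =>
    (f.continuous.Icc_extend' (h := hT0)).continuousOn
  have hext : ∀ f, ∀ t (ht : t ∈ Icc 0 T), ext f t = f ⟨t, ht⟩ := fun f t ht =>
    IccExtend_of_mem hT0 f ht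
  have hextn : ∀ f, ∀ t ∈ Icc 0 T, ‖ext f t‖ ≤ ‖f‖ := fun f t ht => by
    rw [hext f t ht]
    exact f.norm_coe_le_norm _
  let Φ : C(Icc 0 T, E) → C(Icc 0 T, E) := fun f =>
    ⟨fun t => -∫ s in (0 : ℝ)..t, K (t - s) (F s (ext f s)),
      (continuousOn_iff_continuous_domRestrict.mp
        (hK.continuousOn_integral hT (hF.integrableOn (hextc f)))).neg⟩
  have hmaps : MapsTo Φ (Metric.closedBall 0 1) (Metric.closedBall 0 1) := by
    intro f hf
    rw [mem_closedBall_zero_iff] at hf ⊢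
    rw [ContinuousMap.norm_le _ zero_le_one]
    rintro ⟨t, ht⟩
    have h1 := hK.norm_integral_le hT (hF.integrable.mul_const _)
      (hF.norm_le fun s hs => (hextn f s hs).trans hf) ht
    rw [intervalIntegral.integral_mul_const] at h1
    change ‖-_‖ ≤ 1
    rw [norm_neg]
    refine h1.trans ?_
    linarith [hsmall' t ht]
  have hlip : LipschitzWith (1 / 2) (hmaps.restrict Φ _ _) := by
    refine LipschitzWith.of_dist_le_mul ?_
    rintro ⟨f, hf⟩ ⟨g, hg⟩
    rw [mem_closedBall_zero_iff] at hf hg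
    change dist (Φ f) (Φ g) ≤ _ * dist f g
    rw [ContinuousMap.dist_le (by positivity)]
    rintro ⟨t, ht⟩
    change dist (-_) (-_) ≤ _
    rw [dist_neg_neg, dist_eq_norm]
    refine (hF.norm_integral_sub_le hK hT (hextc f) (hextc g) (R := 1)
      (fun s hs => (hextn f s hs).trans hf) (fun s hs => (hextn g s hs).trans hg) ht).trans ?_
    have hsub : Icc 0 t ⊆ Icc 0 T := Icc_subset_Icc le_rfl ht.2
    have hai : IntervalIntegrable a volume 0 t :=
      ((hF.integrable.mono_set hsub).mono_set (uIcc_of_le ht.1).le).intervalIntegrable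
    have h1 : ∫ s in (0 : ℝ)..t, a s * (1 + 1 ^ 2 + 1 ^ 2) * ‖ext f s - ext g s‖ ≤
        ∫ s in (0 : ℝ)..t, a s * (1 + 1 ^ 2 + 1 ^ 2) * dist f g := by
      refine intervalIntegral.integral_mono_ae_restrict ht.1 ?_ ((hai.mul_const _).mul_const _) ?_
      · exact (((IntegrableOn.mul_continuousOn (hF.integrable.mul_const _)
          ((hextc f).sub (hextc g)).norm isCompact_Icc).mono_set hsub).mono_set (uIcc_of_le ht.1).le).intervalIntegrable
      · filter_upwards [ae_mono (Measure.restrict_mono hsub le_rfl) hF.nonneg,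
          ae_restrict_mem measurableSet_Icc] with s hs1 hs2
        rw [hext f s (hsub hs2), hext g s (hsub hs2), ← dist_eq_norm]
        gcongr
        exact ContinuousMap.dist_apply_le_dist _
    rw [intervalIntegral.integral_mul_const, intervalIntegral.integral_mul_const] at h1
    have h2 : (∫ s in (0 : ℝ)..t, a s) * dist f g ≤ 1 / 12 * dist f g :=
      mul_le_mul_of_nonneg_right (hsmall' t ht) dist_nonneg
    refine (mul_le_mul_of_nonneg_left h1 zero_le_two).trans ?_
    push_cast
    linarith
  obtain ⟨f, -, hf, -⟩ := ContractingWith.exists_fixedPoint' (f := Φ)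
    Metric.isClosed_closedBall.isComplete hmaps ⟨by norm_num, hlip⟩
    (Metric.mem_closedBall_self zero_le_one) (edist_ne_top _ _)
  refine ⟨ext f, hextc f, fun t ht => ?_⟩
  rw [hext f t ht]
  exact (congrArg (fun φ : C(Icc 0 T, E) => φ ⟨t, ht⟩) hf).symm

end IsVolterraNonlinearity

end Volterra

/-! ### The wave equation as a Volterra equation -/

lemma isVolterraKernel_waveKernel : IsVolterraKernel waveKernel where
  continuous := continuous_waveKernel
  map_sub := waveKernel_sub
  norm_le t ht f := norm_waveKernel_le (by rw [abs_of_nonneg ht.1]; linarith [ht.2]) f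

/-- The nonlinearity of the equation for `h`, where `u = z + ⟨∇⟩⁻¹ h`. -/
def perturbedCube (z : ℝ → L2) (t : ℝ) (h : L2) : L2 := cube (z t + invBracket h)

lemma sobolevConst_pos : 0 < sobolevConst := by
  unfold sobolevConst
  positivity

lemma normL6_invBracket_ne_top (h : L2) : normL6 (invBracket h) ≠ ∞ :=
  ((normL6_invBracket_le h).trans_lt ENNReal.ofReal_lt_top).ne

lemma toReal_normL6_invBracket_le (h : L2) :
    (normL6 (invBracket h)).toReal ≤ sobolevConst * ‖h‖ :=
  ENNReal.toReal_le_of_le_ofReal (mul_nonneg sobolevConst_pos.le (norm_nonneg _))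
    (normL6_invBracket_le h)

lemma normL6_add_invBracket_ne_top {f : L2} (hf : normL6 f ≠ ∞) (h : L2) :
    normL6 (f + invBracket h) ≠ ∞ :=
  ((normL6_add_le _ _).trans_lt
    (ENNReal.add_lt_top.mpr ⟨hf.lt_top, (normL6_invBracket_ne_top h).lt_top⟩)).ne

lemma toReal_normL6_add_invBracket_le {f : L2} (hf : normL6 f ≠ ∞) (h : L2) :
    (normL6 (f + invBracket h)).toReal ≤ (normL6 f).toReal + sobolevConst * ‖h‖ := by
  refine (ENNReal.toReal_mono (by finiteness [normL6_invBracket_ne_top h])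
    (normL6_add_le _ _)).trans ?_
  rw [ENNReal.toReal_add hf (normL6_invBracket_ne_top h)]
  gcongr
  exact toReal_normL6_invBracket_le h

/-- The constant in the Lipschitz estimate for the perturbed cube. -/
def lipschitzConst : ℝ := 8 * sobolevConst + 4 * sobolevConst ^ 3 + 2

lemma two_le_lipschitzConst : 2 ≤ lipschitzConst := by
  have := sobolevConst_pos
  unfold lipschitzConst
  have : 0 < sobolevConst ^ 3 := by positivity
  linarith

lemma norm_perturbedCube_sub_le {z : ℝ → L2} {t : ℝ} (hz : normL6 (z t) ≠ ∞) (h k : L2) :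
    ‖perturbedCube z t h - perturbedCube z t k‖ ≤
      lipschitzConst * (1 + (normL6 (z t)).toReal ^ 3) * (1 + ‖h‖ ^ 2 + ‖k‖ ^ 2) * ‖h - k‖ := by
  have hS := sobolevConst_pos
  set S := sobolevConst
  set y := (normL6 (z t)).toReal
  have hy : 0 ≤ y := ENNReal.toReal_nonneg
  have hsub : z t + invBracket h - (z t + invBracket k) = invBracket (h - k) := by
    rw [map_sub]
    abel
  have h1 := norm_cube_sub_le (normL6_add_invBracket_ne_top hz h)
    (normL6_add_invBracket_ne_top hz k) (by rw [hsub]; exact normL6_invBracket_ne_top _)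
  rw [hsub] at h1
  have hh := toReal_normL6_add_invBracket_le hz h
  have hk := toReal_normL6_add_invBracket_le hz k
  have hhk := toReal_normL6_invBracket_le (h - k)
  have hsq : ∀ x : ℝ, (y + S * x) ^ 2 ≤ 2 * y ^ 2 + 2 * S ^ 2 * x ^ 2 := fun x => by
    nlinarith [sq_nonneg (y - S * x)]
  have hy2 : y ^ 2 ≤ 1 + y ^ 3 := by
    rcases le_total y 1 with h | h
    · nlinarith [pow_nonneg hy 3]
    · nlinarith [sq_nonneg y]
  calc _ ≤ 2 * (S * ‖h - k‖) * ((y + S * ‖h‖) ^ 2 + (y + S * ‖k‖) ^ 2) := by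
        refine h1.trans ?_
        gcongr
    _ ≤ 2 * (S * ‖h - k‖) * ((2 * y ^ 2 + 2 * S ^ 2 * ‖h‖ ^ 2) +
          (2 * y ^ 2 + 2 * S ^ 2 * ‖k‖ ^ 2)) := by
        gcongr
        · exact hsq _
        · exact hsq _
    _ = (8 * S * y ^ 2 * 1 + 4 * S ^ 3 * 1 * (‖h‖ ^ 2 + ‖k‖ ^ 2)) * ‖h - k‖ := by ring
    _ ≤ (8 * S * (1 + y ^ 3) * (1 + ‖h‖ ^ 2 + ‖k‖ ^ 2) +
          4 * S ^ 3 * (1 + y ^ 3) * (1 + ‖h‖ ^ 2 + ‖k‖ ^ 2) +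
          2 * (1 + y ^ 3) * (1 + ‖h‖ ^ 2 + ‖k‖ ^ 2)) * ‖h - k‖ := by
        have e1 : (1 : ℝ) ≤ 1 + ‖h‖ ^ 2 + ‖k‖ ^ 2 := by
          nlinarith [sq_nonneg ‖h‖, sq_nonneg ‖k‖]
        have e2 : ‖h‖ ^ 2 + ‖k‖ ^ 2 ≤ 1 + ‖h‖ ^ 2 + ‖k‖ ^ 2 := by linarith
        have e3 : (1 : ℝ) ≤ 1 + y ^ 3 := by linarith [pow_nonneg hy 3]
        refine mul_le_mul_of_nonneg_right ?_ (norm_nonneg _)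
        refine (add_le_add (by gcongr) (by gcongr)).trans (le_add_of_nonneg_right (by positivity))
    _ = lipschitzConst * (1 + y ^ 3) * (1 + ‖h‖ ^ 2 + ‖k‖ ^ 2) * ‖h - k‖ := by
        unfold lipschitzConst
        ring

lemma norm_perturbedCube_zero_le {z : ℝ → L2} {t : ℝ} (hz : normL6 (z t) ≠ ∞) :
    ‖perturbedCube z t 0‖ ≤ lipschitzConst * (1 + (normL6 (z t)).toReal ^ 3) := by
  have h1 := norm_cube_sub_le (f := z t) (g := 0) hz (by simp [normL6_zero]) (by simpa using hz)
  rw [cube_zero, sub_zero, sub_zero, normL6_zero, ENNReal.toReal_zero] at h1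
  rw [perturbedCube, map_zero, add_zero]
  have hy : 0 ≤ (normL6 (z t)).toReal := ENNReal.toReal_nonneg
  have := two_le_lipschitzConst
  nlinarith [pow_nonneg hy 3]

section

variable {a b : Freq → ℂ} {T : ℝ}

/-- For `u = S(t)(a, b) + ⟨∇⟩⁻¹ h` the Duhamel formula is a Volterra equation for `h`. -/
lemma isSolution_iff (hT : T ≤ 1) {α : ℝ → ℝ}
    (hF : IsVolterraNonlinearity T α (perturbedCube (linearWave a b)))
    (h6 : ∀ᵐ t ∂volume.restrict (Icc 0 T), normL6 (linearWave a b t) ≠ ∞)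
    {u h : ℝ → L2} (hh : ContinuousOn h (Icc 0 T))
    (hu : ∀ t ∈ Icc 0 T, u t = linearWave a b t + invBracket (h t)) :
    IsSolution a b T u ↔ ∀ t ∈ Icc 0 T,
      h t = -∫ s in (0 : ℝ)..t, waveKernel (t - s) (perturbedCube (linearWave a b) s (h s)) := by
  have hK := isVolterraKernel_waveKernel
  have hint := hF.integrableOn hh
  have hop : ∀ N : ℝ → L2,
      (∀ᵐ t ∂volume.restrict (Icc 0 T), N t = perturbedCube (linearWave a b) t (h t)) →
      ∀ t ∈ Icc 0 T, ∫ s in (0 : ℝ)..t, sinOp (t - s) (N s) = invBracket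
        (∫ s in (0 : ℝ)..t, waveKernel (t - s) (perturbedCube (linearWave a b) s (h s))) := by
    intro N hN t ht
    rw [← ContinuousLinearMap.intervalIntegral_comp_comm _ (hK.intervalIntegrable hT hint ht)]
    refine intervalIntegral.integral_congr_ae ?_
    rw [ae_restrict_iff' measurableSet_Icc] at hN
    filter_upwards [hN] with s hs hs'
    rw [uIoc_of_le ht.1] at hs'
    rw [sinOp_eq_invBracket, hs ⟨hs'.1.le, hs'.2.trans ht.2⟩]
  constructor
  · rintro ⟨N, -, hN, hsol⟩ t ht
    have hN' : ∀ᵐ t ∂volume.restrict (Icc 0 T),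
        N t = perturbedCube (linearWave a b) t (h t) := by
      filter_upwards [hN, ae_restrict_mem measurableSet_Icc] with t h1 h2
      rw [perturbedCube, ← hu t h2]
      exact eq_cube_of_ae_eq h1
    apply invBracket_injective
    have h1 := hsol t ht
    rw [hu t ht, hop N hN' t ht, sub_eq_add_neg] at h1
    rw [map_neg]
    exact add_left_cancel h1
  · intro hv
    refine ⟨fun t => perturbedCube (linearWave a b) t (h t), hint, ?_, fun t ht => ?_⟩
    · filter_upwards [h6, ae_restrict_mem measurableSet_Icc] with t h1 h2
      rw [hu t h2]
      exact coeFn_cube (normL6_add_invBracket_ne_top h1 (h t))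
    · rw [hop _ (Eventually.of_forall fun _ => rfl) t ht, hu t ht, sub_eq_add_neg, ← map_neg,
        ← hv t ht]

/-- A time of existence in terms of a bound `M` for `∫₀¹ ‖S(t)(a, b)‖₆⁶ dt`. -/
def lifespan (M : ℝ) : ℝ := (24 * lipschitzConst * (1 + 24 * lipschitzConst * (1 + M)))⁻¹

lemma lifespan_pos {M : ℝ} (hM : 0 ≤ M) : 0 < lifespan M := by
  have := two_le_lipschitzConst
  unfold lifespan
  positivity

lemma lifespan_le_one {M : ℝ} (hM : 0 ≤ M) : lifespan M ≤ 1 := by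
  have h := two_le_lipschitzConst
  refine inv_le_one_of_one_le₀ ?_
  have : 0 ≤ 24 * lipschitzConst * (1 + M) := by positivity
  nlinarith

lemma measurable_lifespan : Measurable lifespan := by
  unfold lifespan
  fun_prop

/-- The Lipschitz bound `y³`, with `y = ‖S(t)(a, b)‖₆`, is absorbed into `κ + y⁶ / κ` with
`κ ∼ 1 + M`. -/
lemma exists_isVolterraNonlinearity (ha : a ∈ Sobolev 0) (hb : b ∈ Sobolev (-1)) {G : ℝ → ℝ≥0∞}
    (hGm : Measurable G) {M : ℝ} (hM : 0 ≤ M)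
    (hGM : ∫⁻ t in Icc 0 1, G t ≤ ENNReal.ofReal M)
    (hG : ∀ t ∈ Icc (0 : ℝ) 1, normL6 (linearWave a b t) ^ 6 ≤ G t) :
    (∀ᵐ t ∂volume.restrict (Icc 0 (lifespan M)), normL6 (linearWave a b t) ≠ ∞) ∧
    ∃ α : ℝ → ℝ, IsVolterraNonlinearity (lifespan M) α (perturbedCube (linearWave a b)) ∧
      ∫ t in Icc 0 (lifespan M), α t ≤ 1 / 12 := by
  set T := lifespan M with hT
  set z := linearWave a b
  have hT0 : 0 < T := lifespan_pos hM
  have hT1 : T ≤ 1 := lifespan_le_one hM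
  set C := lipschitzConst with hC
  have hC2 : 2 ≤ C := two_le_lipschitzConst
  set κ : ℝ := 24 * C * (1 + M) with hκ
  have hκ0 : 0 < κ := by positivity
  have hsub : Icc 0 T ⊆ Icc 0 1 := Icc_subset_Icc le_rfl hT1
  have hGfin : ∀ᵐ t ∂volume.restrict (Icc 0 1), G t < ∞ :=
    ae_lt_top hGm (hGM.trans_lt ENNReal.ofReal_lt_top).ne
  have hGfinT : ∀ᵐ t ∂volume.restrict (Icc 0 T), G t < ∞ :=
    ae_mono (Measure.restrict_mono hsub le_rfl) hGfin
  have hpow : ∀ {t}, t ∈ Icc 0 T → G t < ∞ →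
      normL6 (z t) ≠ ∞ ∧ (normL6 (z t)).toReal ^ 6 ≤ (G t).toReal := by
    intro t ht hfin
    have h1 := hG t (hsub ht)
    refine ⟨fun h => ?_, ?_⟩
    · rw [h] at h1
      simp only [ENNReal.top_pow (n := 6) (by norm_num), top_le_iff] at h1
      exact hfin.ne h1
    · rw [← ENNReal.toReal_pow]
      exact ENNReal.toReal_mono hfin.ne h1
  have h6 : ∀ᵐ t ∂volume.restrict (Icc 0 T), normL6 (z t) ≠ ∞ := by
    filter_upwards [hGfinT, ae_restrict_mem measurableSet_Icc] with t h1 h2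
    exact (hpow h2 h1).1
  have hGint : IntegrableOn (fun t => (G t).toReal) (Icc 0 T) :=
    (integrable_toReal_of_lintegral_ne_top hGm.aemeasurable
      (hGM.trans_lt ENNReal.ofReal_lt_top).ne).mono_measure (Measure.restrict_mono hsub le_rfl)
  refine ⟨h6, fun t => C * (1 + κ + κ⁻¹ * (G t).toReal), ?_, ?_⟩
  · have hbound : ∀ᵐ t ∂volume.restrict (Icc 0 T),
        C * (1 + (normL6 (z t)).toReal ^ 3) ≤ C * (1 + κ + κ⁻¹ * (G t).toReal) := by
      filter_upwards [hGfinT, ae_restrict_mem measurableSet_Icc] with t h1 h2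
      obtain ⟨-, h3⟩ := hpow h2 h1
      set y := (normL6 (z t)).toReal
      have h4 : y ^ 3 ≤ κ + κ⁻¹ * y ^ 6 := by
        have h5 : 0 ≤ κ⁻¹ * (y ^ 3 - κ) ^ 2 := by positivity
        have h6 : κ⁻¹ * (y ^ 3 - κ) ^ 2 = κ⁻¹ * y ^ 6 - 2 * y ^ 3 + κ := by
          field_simp
          ring
        have h7 : 0 ≤ y ^ 3 := pow_nonneg ENNReal.toReal_nonneg 3
        linarith
      have h5 : κ⁻¹ * y ^ 6 ≤ κ⁻¹ * (G t).toReal := by gcongr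
      refine mul_le_mul_of_nonneg_left ?_ (by linarith)
      linarith
    refine ⟨fun h hh => ?_, ?_, ?_, ?_⟩
    · refine aestronglyMeasurable_cube ?_ ?_
      · exact ((continuous_linearWave ha hb).continuousOn.add
          (invBracket.continuous.comp_continuousOn hh)).aestronglyMeasurable measurableSet_Icc
      · exact h6.mono fun t ht => normL6_add_invBracket_ne_top ht (h t)
    · exact ((integrable_const _).add (hGint.const_mul _)).const_mul C
    · filter_upwards [h6, hbound] with t h1 h2
      exact (norm_perturbedCube_zero_le h1).trans h2
    · filter_upwards [h6, hbound] with t h1 h2 h k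
      refine (norm_perturbedCube_sub_le h1 h k).trans ?_
      gcongr
  · have hGle : ∫ t in Icc 0 T, (G t).toReal ≤ M := by
      rw [integral_toReal hGm.aemeasurable hGfinT]
      refine ENNReal.toReal_le_of_le_ofReal hM ((lintegral_mono_set hsub).trans hGM)
    rw [integral_const_mul, integral_add (integrable_const _) (hGint.const_mul _),
      integral_const, integral_const_mul]
    simp only [measureReal_restrict_apply_univ, Real.volume_real_Icc_of_le hT0.le, sub_zero,
      smul_eq_mul]
    have h1 : C * (T * (1 + κ)) = 1 / 24 := by
      rw [hT, lifespan, ← hC, ← hκ]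
      field_simp
    have h2 : C * (κ⁻¹ * ∫ t in Icc 0 T, (G t).toReal) ≤ 1 / 24 := by
      calc _ ≤ C * (κ⁻¹ * (1 + M)) := by
            gcongr
            linarith
        _ = 1 / 24 := by
            rw [hκ]
            field_simp
    linarith

/-- Local well-posedness of the cubic wave equation in `S(t)(a, b) + C([0,T]; H¹)`, for data whose
linear evolution lies in `L⁶([0,1] × 𝕋³)`. -/
theorem exists_unique_solution (ha : a ∈ Sobolev 0) (hb : b ∈ Sobolev (-1)) {G : ℝ → ℝ≥0∞}
    (hGm : Measurable G) {M : ℝ} (hM : 0 ≤ M)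
    (hGM : ∫⁻ t in Icc 0 1, G t ≤ ENNReal.ofReal M)
    (hG : ∀ t ∈ Icc (0 : ℝ) 1, normL6 (linearWave a b t) ^ 6 ≤ G t) :
    ∃ u ∈ solutionClass a b (lifespan M), IsSolution a b (lifespan M) u ∧
      ∀ w ∈ solutionClass a b (lifespan M), IsSolution a b (lifespan M) w →
        EqOn w u (Icc 0 (lifespan M)) := by
  obtain ⟨h6, α, hF, hsmall⟩ := exists_isVolterraNonlinearity ha hb hGm hM hGM hG
  have hK := isVolterraKernel_waveKernel
  have hT1 := lifespan_le_one hM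
  obtain ⟨h, hc, hh⟩ := hF.exists_solution hK (lifespan_pos hM).le hT1 hsmall
  refine ⟨fun t => linearWave a b t + invBracket (h t),
    ⟨fun t => invBracket (h t), mem_CSobolev_one_iff.mpr ⟨h, hc, fun _ _ => rfl⟩, fun _ _ => rfl⟩,
    (isSolution_iff hT1 hF h6 hc fun _ _ => rfl).mpr hh, ?_⟩
  rintro w ⟨v, hv, hwv⟩ hw t ht
  obtain ⟨k, hkc, hk⟩ := mem_CSobolev_one_iff.mp hv
  have hwk : ∀ t ∈ Icc 0 (lifespan M), w t = linearWave a b t + invBracket (k t) :=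
    fun t ht => by rw [hwv t ht, hk t ht]
  have hke := (isSolution_iff hT1 hF h6 hkc hwk).mp hw
  rw [hwk t ht, hF.eqOn_of_solutions hK hT1 hkc hc hke hh ht]

end

/-! ### Real-valued solutions -/

section Conj

/-- Complex conjugation as a real-linear operator on `L²`. -/
def conjL2 : L2 →L[ℝ] L2 := Complex.conjCLE.toContinuousLinearMap.compLpL 2 torusMeasure

lemma coeFn_conjL2 (f : L2) : conjL2 f =ᵐ[torusMeasure] fun x => conj (f x) :=
  ContinuousLinearMap.coeFn_compLpL _ f

lemma coeff_conjL2 (f : L2) (n : Freq) : coeff (conjL2 f) n = conj (coeff f (-n)) := by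
  rw [coeff, coeff, UnitAddTorus.mFourierCoeff, UnitAddTorus.mFourierCoeff, ← integral_conj]
  refine integral_congr_ae ?_
  have h := coeFn_conjL2 f
  filter_upwards [h] with x hx
  rw [hx, smul_eq_mul, smul_eq_mul, map_mul, ← UnitAddTorus.mFourier_neg, neg_neg]

lemma isRealFun_of_conjL2_eq {f : L2} (h : conjL2 f = f) : IsRealFun f := by
  have h1 := coeFn_conjL2 f
  rw [h] at h1
  filter_upwards [h1] with x hx
  exact Complex.conj_eq_iff_im.mp hx.symm

lemma sinSymbol_neg (t : ℝ) (n : Freq) : sinSymbol t (-n) = sinSymbol t n := by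
  simp [sinSymbol, freqNorm_neg]

lemma cosSymbol_neg (t : ℝ) (n : Freq) : cosSymbol t (-n) = cosSymbol t n := by
  simp [cosSymbol, freqNorm_neg]

lemma bracket_neg (n : Freq) : bracket (-n) = bracket n := by simp [bracket, freqNorm_neg]

lemma conjL2_invBracket (f : L2) : conjL2 (invBracket f) = invBracket (conjL2 f) := by
  apply coeff_injective
  ext n
  simp [coeff_conjL2, coeff_invBracket, bracket_neg]

lemma conjL2_sinOp (t : ℝ) (f : L2) : conjL2 (sinOp t f) = sinOp t (conjL2 f) := by
  have h : ∀ g n, coeff (waveKernel t g) n = (bracket n * sinSymbol t n : ℝ) * coeff g n :=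
    coeff_multiplier (abs_bracket_mul_sinSymbol_le t)
  rw [sinOp_eq_invBracket, sinOp_eq_invBracket, conjL2_invBracket]
  congr 1
  apply coeff_injective
  ext n
  simp [coeff_conjL2, h, bracket_neg, sinSymbol_neg]

variable {a b : Freq → ℂ} {T : ℝ}

lemma conjL2_linearWave (ha : a ∈ Sobolev 0) (hb : b ∈ Sobolev (-1)) (har : IsRealDist a)
    (hbr : IsRealDist b) (t : ℝ) : conjL2 (linearWave a b t) = linearWave a b t := by
  apply coeff_injective
  ext n
  rw [coeff_conjL2, coeff_linearWave ha hb]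
  simp [waveCoeff, har n, hbr n, sinSymbol_neg, cosSymbol_neg]

lemma conjL2_mem_solutionClass (ha : a ∈ Sobolev 0) (hb : b ∈ Sobolev (-1)) (har : IsRealDist a)
    (hbr : IsRealDist b) {u : ℝ → L2} (hu : u ∈ solutionClass a b T) :
    (fun t => conjL2 (u t)) ∈ solutionClass a b T := by
  obtain ⟨v, hv, huv⟩ := hu
  obtain ⟨h, hc, hh⟩ := mem_CSobolev_one_iff.mp hv
  refine ⟨fun t => conjL2 (v t), mem_CSobolev_one_iff.mpr ⟨fun t => conjL2 (h t),
    conjL2.continuous.comp_continuousOn hc, fun t ht => ?_⟩, fun t ht => ?_⟩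
  · rw [hh t ht, conjL2_invBracket]
  · beta_reduce
    rw [huv t ht, map_add, conjL2_linearWave ha hb har hbr]

/-- The complex conjugate of a solution with real data is again a solution. -/
lemma IsSolution.conjL2 (ha : a ∈ Sobolev 0) (hb : b ∈ Sobolev (-1)) (har : IsRealDist a)
    (hbr : IsRealDist b) (hT : T ≤ 1) {u : ℝ → L2} (hu : IsSolution a b T u) :
    IsSolution a b T fun t => conjL2 (u t) := by
  obtain ⟨N, hN, hNu, hsol⟩ := hu
  refine ⟨fun t => CubicNLW.conjL2 (N t), CubicNLW.conjL2.integrable_comp hN, ?_, fun t ht => ?_⟩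
  · filter_upwards [hNu] with t ht
    filter_upwards [ht, coeFn_conjL2 (N t), coeFn_conjL2 (u t)] with x h1 h2 h3
    rw [h2, h3, h1, map_pow]
  · have hint : IntervalIntegrable (fun s => sinOp (t - s) (N s)) volume 0 t := by
      have h1 := isVolterraKernel_waveKernel.intervalIntegrable hT hN ht
      simp_rw [sinOp_eq_invBracket]
      exact ⟨invBracket.integrable_comp h1.1, invBracket.integrable_comp h1.2⟩
    simp_rw [← conjL2_sinOp]
    rw [ContinuousLinearMap.intervalIntegral_comp_comm _ hint, hsol t ht, map_sub,
      conjL2_linearWave ha hb har hbr]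

end Conj

/-! ### Moments of sub-Gaussian sums -/

section Moments

variable {Ω : Type*} [MeasurableSpace Ω] {P : Measure Ω}

/-- The sixth moment of a sub-Gaussian variable, from `y⁶ ≤ 6! (e^y + e^{-y})` with
`y = X / √v`. -/
lemma _root_.ProbabilityTheory.HasSubgaussianMGF.eLpNorm_six_le {X : Ω → ℝ} {v : NNReal}
    (h : HasSubgaussianMGF X v P) : eLpNorm X 6 P ≤ ENNReal.ofReal (4 * Real.sqrt v) := by
  rcases eq_or_ne v 0 with rfl | hv
  · rw [eLpNorm_congr_ae h.ae_eq_zero_of_hasSubgaussianMGF_zero, eLpNorm_zero]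
    exact zero_le
  have hv0 : (0 : ℝ) < v := by positivity
  set γ : ℝ := (Real.sqrt v)⁻¹ with hγ
  have hγ0 : 0 < γ := by positivity
  have hγ2 : v * γ ^ 2 = 1 := by
    rw [hγ, inv_pow, Real.sq_sqrt hv0.le, mul_inv_cancel₀ hv0.ne']
  have hexp : Real.exp (1 / 2) ≤ 2 := by
    have h1 := Real.exp_one_lt_d9
    have h2 : Real.exp (1 / 2) ^ 2 = Real.exp 1 := by
      rw [← Real.exp_nat_mul]
      norm_num
    nlinarith [Real.exp_pos (1 / 2)]
  have hmgf : ∀ t : ℝ, t ^ 2 = γ ^ 2 →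
      ∫⁻ ω, ENNReal.ofReal (Real.exp (t * X ω)) ∂P ≤ ENNReal.ofReal 2 := by
    intro t ht
    rw [← ofReal_integral_eq_lintegral_ofReal (h.integrable_exp_mul t)
      (Eventually.of_forall fun _ => (Real.exp_pos _).le)]
    refine ENNReal.ofReal_le_ofReal (((h.mgf_le t).trans_eq ?_).trans hexp)
    rw [ht, hγ2]
  have hpt : ∀ x : ℝ, ‖x‖ₑ ^ 6 ≤ ENNReal.ofReal (720 * Real.sqrt v ^ 6) *
      (ENNReal.ofReal (Real.exp (γ * x)) + ENNReal.ofReal (Real.exp (-γ * x))) := by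
    intro x
    rw [← ENNReal.ofReal_add (Real.exp_pos _).le (Real.exp_pos _).le,
      ← ENNReal.ofReal_mul (by positivity), ← ofReal_norm, ← ENNReal.ofReal_pow (norm_nonneg _)]
    refine ENNReal.ofReal_le_ofReal ?_
    have h1 := Real.pow_div_factorial_le_exp (x := |γ * x|) (abs_nonneg _) 6
    have h2 : Real.exp |γ * x| ≤ Real.exp (γ * x) + Real.exp (-γ * x) := by
      rw [neg_mul]
      rcases abs_choice (γ * x) with h | h <;> rw [h]
      · exact le_add_of_nonneg_right (Real.exp_pos _).le
      · exact le_add_of_nonneg_left (Real.exp_pos _).le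
    have h3 : (Nat.factorial 6 : ℝ) = 720 := by norm_num [Nat.factorial]
    have h5 : |γ * x| ^ 6 = γ ^ 6 * |x| ^ 6 := by rw [abs_mul, abs_of_pos hγ0, mul_pow]
    rw [h3, div_le_iff₀ (by norm_num), h5] at h1
    have h4 : Real.sqrt v ^ 6 * γ ^ 6 = 1 := by
      rw [← mul_pow, hγ, mul_inv_cancel₀ (by positivity), one_pow]
    calc ‖x‖ ^ 6 = Real.sqrt v ^ 6 * (γ ^ 6 * |x| ^ 6) := by
          rw [← mul_assoc, h4, one_mul, Real.norm_eq_abs]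
      _ ≤ Real.sqrt v ^ 6 * (Real.exp |γ * x| * 720) := by gcongr
      _ ≤ Real.sqrt v ^ 6 * ((Real.exp (γ * x) + Real.exp (-γ * x)) * 720) := by gcongr
      _ = _ := by ring
  have hpow : eLpNorm X 6 P ^ 6 = ∫⁻ ω, ‖X ω‖ₑ ^ 6 ∂P := by
    have := eLpNorm_nnreal_pow_eq_lintegral (f := X) (μ := P) (p := 6) (by norm_num)
    simp only [NNReal.coe_ofNat, ENNReal.rpow_ofNat] at this
    exact this
  refine (ENNReal.pow_le_pow_left_iff (n := 6) (by norm_num)).mp ?_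
  rw [hpow]
  calc ∫⁻ ω, ‖X ω‖ₑ ^ 6 ∂P ≤ ∫⁻ ω, ENNReal.ofReal (720 * Real.sqrt v ^ 6) *
        (ENNReal.ofReal (Real.exp (γ * X ω)) + ENNReal.ofReal (Real.exp (-γ * X ω))) ∂P :=
        lintegral_mono fun ω => hpt _
    _ ≤ ENNReal.ofReal (720 * Real.sqrt v ^ 6) * (ENNReal.ofReal 2 + ENNReal.ofReal 2) := by
        rw [lintegral_const_mul' _ _ ENNReal.ofReal_ne_top, lintegral_add_left'
          (h.integrable_exp_mul γ).aestronglyMeasurable.aemeasurable.ennreal_ofReal]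
        gcongr
        · exact hmgf γ rfl
        · exact hmgf (-γ) (neg_sq γ)
    _ ≤ ENNReal.ofReal (4 * Real.sqrt v) ^ 6 := by
        rw [← ENNReal.ofReal_add (by norm_num) (by norm_num), ← ENNReal.ofReal_mul (by positivity),
          ← ENNReal.ofReal_pow (by positivity)]
        refine ENNReal.ofReal_le_ofReal ?_
        have : 0 ≤ Real.sqrt v ^ 6 := by positivity
        rw [mul_pow]
        linarith

lemma eLpNorm_sum_mul_le {ι : Type*} {X : ι → Ω → ℝ} (hX : iIndepFun X P) {v : NNReal}
    (hv : ∀ i, HasSubgaussianMGF (X i) v P) (s : Finset ι) (r : ι → ℝ) {A : ℝ}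
    (hr : ∑ i ∈ s, r i ^ 2 ≤ A) :
    eLpNorm (fun ω => ∑ i ∈ s, r i * X i ω) 6 P ≤ ENNReal.ofReal (4 * Real.sqrt (v * A)) := by
  have hind : iIndepFun (fun i ω => r i * X i ω) P :=
    hX.comp (fun i x => r i * x) fun i => measurable_const_mul _
  have h1 := (HasSubgaussianMGF.sum_of_iIndepFun hind (s := s)
    fun i _ => (hv i).const_mul (r i)).eLpNorm_six_le
  refine h1.trans (ENNReal.ofReal_le_ofReal ?_)
  gcongr
  rw [NNReal.coe_sum]
  change ∑ i ∈ s, r i ^ 2 * (v : ℝ) ≤ _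
  rw [← Finset.sum_mul, mul_comm]
  gcongr

/-- Khinchine's inequality for complex sub-Gaussian variables; the real and imaginary parts of a
single variable may be dependent. -/
lemma eLpNorm_sum_complex_le {ι : Type*} {g : ι → Ω → ℂ} (hg : iIndepFun g P) {v : NNReal}
    (hre : ∀ i, HasSubgaussianMGF (fun ω => (g i ω).re) v P)
    (him : ∀ i, HasSubgaussianMGF (fun ω => (g i ω).im) v P) (s : Finset ι) (α : ι → ℂ) {A : ℝ}
    (hA : ∑ i ∈ s, ‖α i‖ ^ 2 ≤ A) :
    eLpNorm (fun ω => ∑ i ∈ s, α i * g i ω) 6 P ≤ ENNReal.ofReal (16 * Real.sqrt (v * A)) := by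
  have hgre : iIndepFun (fun i ω => (g i ω).re) P :=
    hg.comp (fun _ => Complex.re) fun _ => Complex.measurable_re
  have hgim : iIndepFun (fun i ω => (g i ω).im) P :=
    hg.comp (fun _ => Complex.im) fun _ => Complex.measurable_im
  have hAre : ∑ i ∈ s, (α i).re ^ 2 ≤ A := le_trans (Finset.sum_le_sum fun i _ => by
    rw [Complex.sq_norm, Complex.normSq_apply]; nlinarith [sq_nonneg (α i).im]) hA
  have hAim : ∑ i ∈ s, (α i).im ^ 2 ≤ A := le_trans (Finset.sum_le_sum fun i _ => by
    rw [Complex.sq_norm, Complex.normSq_apply]; nlinarith [sq_nonneg (α i).re]) hA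
  have h1 := eLpNorm_sum_mul_le hgre hre s (fun i => (α i).re) hAre
  have h2 := eLpNorm_sum_mul_le hgim him s (fun i => (α i).im) hAim
  have h3 := eLpNorm_sum_mul_le hgim him s (fun i => (α i).re) hAre
  have h4 := eLpNorm_sum_mul_le hgre hre s (fun i => (α i).im) hAim
  have hm : ∀ {X : ι → Ω → ℝ}, (∀ i, HasSubgaussianMGF (X i) v P) → ∀ r : ι → ℝ,
      AEStronglyMeasurable (fun ω => ‖∑ i ∈ s, r i * X i ω‖) P := fun hX r =>
    (Finset.aestronglyMeasurable_fun_sum s fun i _ =>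
      ((hX i).aestronglyMeasurable.const_mul (r i))).norm
  have hpt : ∀ ω, ‖∑ i ∈ s, α i * g i ω‖ ≤ ‖∑ i ∈ s, (α i).re * (g i ω).re‖ +
      ‖∑ i ∈ s, (α i).im * (g i ω).im‖ + (‖∑ i ∈ s, (α i).re * (g i ω).im‖ +
      ‖∑ i ∈ s, (α i).im * (g i ω).re‖) := by
    intro ω
    refine (Complex.norm_le_abs_re_add_abs_im _).trans ?_
    rw [Complex.re_sum, Complex.im_sum]
    simp only [Complex.mul_re, Complex.mul_im, Finset.sum_sub_distrib, Finset.sum_add_distrib]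
    exact add_le_add (abs_sub _ _) (abs_add_le _ _)
  refine (eLpNorm_mono_real hpt).trans ?_
  have h6 : (1 : ℝ≥0∞) ≤ 6 := by norm_num
  refine (eLpNorm_add_le ((hm hre _).add (hm him _)) ((hm him _).add (hm hre _)) h6).trans ?_
  refine (add_le_add (eLpNorm_add_le (hm hre _) (hm him _) h6)
    (eLpNorm_add_le (hm him _) (hm hre _) h6)).trans ?_
  simp only [eLpNorm_norm]
  refine (add_le_add (add_le_add h1 h2) (add_le_add h3 h4)).trans_eq ?_
  rw [← ENNReal.ofReal_add (by positivity) (by positivity),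
    ← ENNReal.ofReal_add (by positivity) (by positivity)]
  congr 1
  ring

end Moments

/-! ### Moments of the randomised Fourier series -/

/-- A set containing exactly one of `n` and `-n` for each frequency `n ≠ 0`. -/
def halfLattice : Set Freq :=
  {n | 0 < n 0 ∨ (n 0 = 0 ∧ (0 < n 1 ∨ (n 1 = 0 ∧ 0 ≤ n 2)))}

lemma neg_notMem_halfLattice {n : Freq} (hn : n ∈ halfLattice) (h0 : n ≠ 0) :
    -n ∉ halfLattice := by
  intro h
  simp only [halfLattice, mem_ofPred_eq, Pi.neg_apply] at hn h
  apply h0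
  ext i
  fin_cases i <;> simp <;> omega

lemma neg_mem_halfLattice {n : Freq} (hn : n ∉ halfLattice) : -n ∈ halfLattice := by
  simp only [halfLattice, mem_ofPred_eq, Pi.neg_apply] at hn ⊢
  omega

section Randomizer

variable {Ω : Type*} [MeasurableSpace Ω] {P : Measure Ω} {g : Fin 2 → Freq → Ω → ℂ}

lemma IsRandomizer.exists_hasSubgaussianMGF (hg : IsRandomizer P g) :
    ∃ v : NNReal, ∀ j n, HasSubgaussianMGF (fun ω => (g j n ω).re) v P ∧
      HasSubgaussianMGF (fun ω => (g j n ω).im) v P := by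
  obtain ⟨c, hc⟩ := hg.exp_moment
  have hle : ∀ t : ℝ, Real.exp (c * t ^ 2) ≤
      Real.exp ((2 * Real.toNNReal c : NNReal) * t ^ 2 / 2) := fun t => by
    rw [Real.exp_le_exp]
    push_cast
    have := mul_le_mul_of_nonneg_right (Real.le_coe_toNNReal c) (sq_nonneg t)
    linarith
  exact ⟨2 * Real.toNNReal c, fun j n =>
    ⟨⟨fun t => (hc j n t).1.1, fun t => (hc j n t).1.2.trans (hle t)⟩,
      ⟨fun t => (hc j n t).2.1, fun t => (hc j n t).2.2.trans (hle t)⟩⟩⟩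

variable {v : NNReal}

lemma IsRandomizer.eLpNorm_sum_filter_le (hg : IsRandomizer P g)
    (hv : ∀ j n, HasSubgaussianMGF (fun ω => (g j n ω).re) v P ∧
      HasSubgaussianMGF (fun ω => (g j n ω).im) v P)
    {A : Set Freq} (hA : ∀ n ∈ A, n ≠ 0 → -n ∉ A) [DecidablePred (· ∈ A)] (B : Finset Freq)
    (α : Fin 2 → Freq → ℂ) {Q : ℝ} (hQ : ∑ n ∈ B, ∑ j, ‖α j n‖ ^ 2 ≤ Q) :
    eLpNorm (fun ω => ∑ n ∈ B with n ∈ A, ∑ j, α j n * g j n ω) 6 P ≤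
      ENNReal.ofReal (16 * Real.sqrt (v * Q)) := by
  have hsum : ∀ {M : Type} [AddCommMonoid M] (f : Fin 2 → Freq → M),
      ∑ n ∈ B with n ∈ A, ∑ j, f j n =
        ∑ p ∈ (Finset.univ : Finset (Fin 2)) ×ˢ B.subtype (· ∈ A), f p.1 p.2 := by
    intro M _ f
    rw [Finset.sum_product, Finset.sum_comm]
    refine Finset.sum_congr rfl fun j _ => ?_
    rw [← Finset.sum_subtype_eq_sum_filter]
  simp_rw [hsum]
  refine eLpNorm_sum_complex_le (g := fun (p : Fin 2 × A) => g p.1 p.2) (hg.indep A hA)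
    (fun p => (hv p.1 p.2).1) (fun p => (hv p.1 p.2).2) _ (fun p => α p.1 p.2) ?_
  rw [← hsum fun j n => ‖α j n‖ ^ 2]
  exact (Finset.sum_le_sum_of_subset_of_nonneg (Finset.filter_subset _ _)
    fun n _ _ => Finset.sum_nonneg fun j _ => sq_nonneg _).trans hQ

/-- Khinchine's inequality for the randomising family: the frequencies are split into two halves,
each without opposite pairs. -/
lemma IsRandomizer.eLpNorm_sum_le (hg : IsRandomizer P g)
    (hv : ∀ j n, HasSubgaussianMGF (fun ω => (g j n ω).re) v P ∧
      HasSubgaussianMGF (fun ω => (g j n ω).im) v P) (B : Finset Freq)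
    (α : Fin 2 → Freq → ℂ) {Q : ℝ} (hQ : ∑ n ∈ B, ∑ j, ‖α j n‖ ^ 2 ≤ Q) :
    eLpNorm (fun ω => ∑ n ∈ B, ∑ j, α j n * g j n ω) 6 P ≤
      ENNReal.ofReal (32 * Real.sqrt (v * Q)) := by
  classical
  have h1 := hg.eLpNorm_sum_filter_le hv (A := halfLattice)
    (fun n hn h0 => neg_notMem_halfLattice hn h0) B α hQ
  have h2 := hg.eLpNorm_sum_filter_le hv (A := halfLatticeᶜ)
    (fun n hn _ h => h (neg_mem_halfLattice hn)) B α hQ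
  have hm : ∀ B : Finset Freq, AEStronglyMeasurable (fun ω => ∑ n ∈ B, ∑ j, α j n * g j n ω) P :=
    fun B => (Finset.measurable_fun_sum _ fun n _ => Finset.measurable_fun_sum _ fun j _ =>
      (hg.measurable j n).const_mul _).aestronglyMeasurable
  have hsplit : (fun ω => ∑ n ∈ B, ∑ j, α j n * g j n ω) =
      (fun ω => ∑ n ∈ B with n ∈ halfLattice, ∑ j, α j n * g j n ω) +
        fun ω => ∑ n ∈ B with n ∈ halfLatticeᶜ, ∑ j, α j n * g j n ω := by
    ext ω
    exact (Finset.sum_filter_add_sum_filter_not B _ _).symm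
  rw [hsplit]
  refine (eLpNorm_add_le (hm _) (hm _) (by norm_num)).trans ((add_le_add h1 h2).trans_eq ?_)
  rw [← ENNReal.ofReal_add (by positivity) (by positivity)]
  congr 1
  ring

/-- Second moments of the randomising variables are bounded. -/
lemma IsRandomizer.lintegral_sq_le [IsProbabilityMeasure P] (hg : IsRandomizer P g)
    (hv : ∀ j n, HasSubgaussianMGF (fun ω => (g j n ω).re) v P ∧
      HasSubgaussianMGF (fun ω => (g j n ω).im) v P) (j : Fin 2) (n : Freq) :
    ∫⁻ ω, ‖g j n ω‖ₑ ^ 2 ∂P ≤ ENNReal.ofReal (32 * Real.sqrt v) ^ 2 := by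
  have h1 := hg.eLpNorm_sum_le hv {n} (fun i _ => if i = j then 1 else 0) (Q := 1) (by
    simp [apply_ite, ite_pow])
  simp only [Finset.sum_singleton, ite_mul, one_mul, zero_mul, Finset.sum_ite_eq',
    Finset.mem_univ, if_true, mul_one] at h1
  have h2 := eLpNorm_le_eLpNorm_of_exponent_le (p := 2) (q := 6) (μ := P) (by norm_num)
    (hg.measurable j n).aestronglyMeasurable
  have h3 := eLpNorm_nnreal_pow_eq_lintegral (f := g j n) (μ := P) (p := 2) (by norm_num)
  simp only [NNReal.coe_ofNat, ENNReal.rpow_ofNat] at h3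
  change eLpNorm (g j n) 2 P ^ 2 = _ at h3
  rw [← h3]
  gcongr
  exact h2.trans h1

/-- Randomisation almost surely preserves Sobolev regularity. -/
lemma IsRandomizer.ae_randomize_mem_sobolev [IsProbabilityMeasure P] (hg : IsRandomizer P g)
    {σ : ℝ} {a : Freq → ℂ} (ha : a ∈ Sobolev σ) (j : Fin 2) :
    ∀ᵐ ω ∂P, randomize (g j) a ω ∈ Sobolev σ := by
  obtain ⟨v, hv⟩ := hg.exists_hasSubgaussianMGF
  simp_rw [sobolev_iff_tsum] at ha ⊢
  have hterm : ∀ ω n, ENNReal.ofReal ((1 + freqNorm n ^ 2) ^ σ * ‖randomize (g j) a ω n‖ ^ 2) =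
      ENNReal.ofReal ((1 + freqNorm n ^ 2) ^ σ * ‖a n‖ ^ 2) * ‖g j n ω‖ₑ ^ 2 := by
    intro ω n
    rw [← ofReal_norm, ← ENNReal.ofReal_pow (norm_nonneg _),
      ← ENNReal.ofReal_mul (by positivity), randomize, norm_mul]
    congr 1
    ring
  simp_rw [hterm]
  refine ae_lt_top (Measurable.tsum fun n =>
    ((hg.measurable j n).enorm.pow_const 2).const_mul _) (ne_of_lt ?_)
  rw [lintegral_tsum fun n =>
    (((hg.measurable j n).enorm.pow_const 2).const_mul _).aemeasurable]
  calc _ ≤ ∑' n, ENNReal.ofReal ((1 + freqNorm n ^ 2) ^ σ * ‖a n‖ ^ 2) *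
        ENNReal.ofReal (32 * Real.sqrt v) ^ 2 := by
        refine ENNReal.tsum_le_tsum fun n => ?_
        rw [lintegral_const_mul' _ _ ENNReal.ofReal_ne_top]
        gcongr
        exact hg.lintegral_sq_le hv j n
    _ < ∞ := by
        rw [ENNReal.tsum_mul_right]
        finiteness

lemma IsRandomizer.ae_isRealDist (hg : IsRandomizer P g) (j : Fin 2) {a : Freq → ℂ} :
    ∀ᵐ ω ∂P, IsRealDist a → IsRealDist (randomize (g j) a ω) := by
  have h : ∀ᵐ ω ∂P, ∀ n, g j (-n) ω = conj (g j n ω) := ae_all_iff.mpr (hg.symm j)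
  filter_upwards [h] with ω hω ha n
  simp [randomize, hω n, ha n]

end Randomizer

/-! ### The random linear evolution in `L⁶` -/

/-- Lower semicontinuity of the `L⁶` norm with respect to convergence in `L²`. -/
lemma lintegral_pow_six_le_liminf {f : L2} {F : ℕ → L2} (h : Tendsto F atTop (𝓝 f)) :
    ∫⁻ x, ‖f x‖ₑ ^ 6 ∂torusMeasure ≤
      liminf (fun m => ∫⁻ x, ‖F m x‖ₑ ^ 6 ∂torusMeasure) atTop := by
  refine le_of_forall_gt_imp_ge_of_dense fun c hc => ?_
  obtain ⟨φ, hφ, hφc⟩ := extraction_of_frequently_atTop (frequently_lt_of_liminf_lt (h := hc))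
  obtain ⟨ψ, -, hψ⟩ :=
    (tendstoInMeasure_of_tendsto_Lp (h.comp hφ.tendsto_atTop)).exists_seq_tendsto_ae
  calc ∫⁻ x, ‖f x‖ₑ ^ 6 ∂torusMeasure
      = ∫⁻ x, liminf (fun i => ‖F (φ (ψ i)) x‖ₑ ^ 6) atTop ∂torusMeasure := by
        refine lintegral_congr_ae ?_
        filter_upwards [hψ] with x hx
        exact (Tendsto.liminf_eq ((ENNReal.continuous_pow 6).tendsto _ |>.comp hx.enorm)).symm
    _ ≤ liminf (fun i => ∫⁻ x, ‖F (φ (ψ i)) x‖ₑ ^ 6 ∂torusMeasure) atTop :=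
        lintegral_liminf_le' fun i => (Lp.aestronglyMeasurable _).enorm.pow_const 6
    _ ≤ c := by
        refine liminf_le_of_le (by isBoundedDefault) fun b hb => ?_
        obtain ⟨i, hi⟩ := hb.exists
        exact hi.trans (hφc (ψ i)).le

/-- The Fourier partial sum of `S(t)(a, b)` over the box of size `m`, at the point `x`. -/
def wavePartialSum (a b : Freq → ℂ) (m : ℕ) (t : ℝ) (x : T3) : ℂ :=
  ∑ n ∈ freqBox m, waveCoeff a b t n * UnitAddTorus.mFourier n x

/-- A majorant for the sixth power of the `L⁶` norm of `S(t)(a, b)`. Being a lower limit of norms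
of trigonometric polynomials, it is measurable in `t` and in any parameter on which the
coefficients of `a` and `b` depend measurably. -/
def waveEnvelope (a b : Freq → ℂ) (t : ℝ) : ℝ≥0∞ :=
  liminf (fun m => ∫⁻ x, ‖wavePartialSum a b m t x‖ₑ ^ 6 ∂torusMeasure) atTop

lemma normL6_linearWave_le {a b : Freq → ℂ} (ha : a ∈ Sobolev 0) (hb : b ∈ Sobolev (-1)) (t : ℝ) :
    normL6 (linearWave a b t) ^ 6 ≤ waveEnvelope a b t := by
  rw [normL6_pow_six]
  refine (lintegral_pow_six_le_liminf
    ((hasSum_fourierSeries (summable_sq_waveCoeff ha hb t)).comp tendsto_freqBox)).trans_eq ?_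
  refine congrArg (fun u : ℕ → ℝ≥0∞ => liminf u atTop) (funext fun m => lintegral_congr_ae ?_)
  filter_upwards [coeFn_partialSum (freqBox m) (waveCoeff a b t)] with x hx
  rw [wavePartialSum, ← hx]
  rfl

section RandomWave

variable {Ω : Type*} [MeasurableSpace Ω] {P : Measure Ω} {g : Fin 2 → Freq → Ω → ℂ}

lemma IsRandomizer.measurable_wavePartialSum (hg : IsRandomizer P g) (u₀ u₁ : Freq → ℂ) (m : ℕ) :
    Measurable fun p : (Ω × ℝ) × T3 => wavePartialSum (randomize (g 0) u₀ p.1.1)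
      (randomize (g 1) u₁ p.1.1) m p.1.2 p.2 := by
  unfold wavePartialSum waveCoeff randomize
  refine Finset.measurable_fun_sum _ fun n _ => ?_
  have h0 := hg.measurable 0 n
  have h1 := hg.measurable 1 n
  have hc : Measurable fun t : ℝ => (cosSymbol t n : ℂ) :=
    (Complex.continuous_ofReal.comp (continuous_cosSymbol n)).measurable
  have hs : Measurable fun t : ℝ => (sinSymbol t n : ℂ) :=
    (Complex.continuous_ofReal.comp (continuous_sinSymbol n)).measurable
  have he : Measurable fun x : T3 => UnitAddTorus.mFourier n x :=
    (UnitAddTorus.mFourier n).continuous.measurable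
  have hω : Measurable fun p : (Ω × ℝ) × T3 => p.1.1 := measurable_fst.comp measurable_fst
  have ht : Measurable fun p : (Ω × ℝ) × T3 => p.1.2 := measurable_snd.comp measurable_fst
  exact (((hc.comp ht).mul ((h0.comp hω).mul_const _)).add
    ((hs.comp ht).mul ((h1.comp hω).mul_const _))).mul (he.comp measurable_snd)

lemma IsRandomizer.measurable_lintegral_wavePartialSum (hg : IsRandomizer P g)
    (u₀ u₁ : Freq → ℂ) (m : ℕ) :
    Measurable fun p : Ω × ℝ => ∫⁻ x, ‖wavePartialSum (randomize (g 0) u₀ p.1)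
      (randomize (g 1) u₁ p.1) m p.2 x‖ₑ ^ 6 ∂torusMeasure :=
  Measurable.lintegral_prod_right' ((hg.measurable_wavePartialSum u₀ u₁ m).enorm.pow_const 6)

lemma IsRandomizer.measurable_waveEnvelope (hg : IsRandomizer P g) (u₀ u₁ : Freq → ℂ) :
    Measurable fun p : Ω × ℝ => waveEnvelope (randomize (g 0) u₀ p.1)
      (randomize (g 1) u₁ p.1) p.2 :=
  Measurable.liminf (hg.measurable_lintegral_wavePartialSum u₀ u₁)

/-- At each point of space-time the random linear evolution has a bounded sixth moment. -/
lemma IsRandomizer.exists_lintegral_wavePartialSum_le (hg : IsRandomizer P g) {u₀ u₁ : Freq → ℂ}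
    (hu₀ : u₀ ∈ Sobolev 0) (hu₁ : u₁ ∈ Sobolev (-1)) :
    ∃ D : ℝ, ∀ m, ∀ t ∈ Icc (0 : ℝ) 1, ∀ x : T3,
      ∫⁻ ω, ‖wavePartialSum (randomize (g 0) u₀ ω) (randomize (g 1) u₁ ω) m t x‖ₑ ^ 6 ∂P ≤
        ENNReal.ofReal D ^ 6 := by
  obtain ⟨v, hv⟩ := hg.exists_hasSubgaussianMGF
  have hs₀ := sobolev_zero_iff.mp hu₀
  have hs₁ := (sobolev_neg_one_iff.mp hu₁).mul_left 4
  refine ⟨32 * Real.sqrt (v * ∑' n, (‖u₀ n‖ ^ 2 + 4 * ((bracket n)⁻¹ * ‖u₁ n‖) ^ 2)), ?_⟩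
  intro m t ht x
  set α : Fin 2 → Freq → ℂ := ![fun n => cosSymbol t n * u₀ n * UnitAddTorus.mFourier n x,
    fun n => sinSymbol t n * u₁ n * UnitAddTorus.mFourier n x] with hα
  have hsum : ∀ ω, wavePartialSum (randomize (g 0) u₀ ω) (randomize (g 1) u₁ ω) m t x =
      ∑ n ∈ freqBox m, ∑ j, α j n * g j n ω := by
    intro ω
    refine Finset.sum_congr rfl fun n _ => ?_
    simp only [hα, waveCoeff, randomize, Fin.sum_univ_two, Matrix.cons_val_zero,
      Matrix.cons_val_one]
    ring
  have hα0 : ∀ n, ‖α 0 n‖ ^ 2 ≤ ‖u₀ n‖ ^ 2 := fun n => by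
    have h0 : α 0 n = cosSymbol t n * u₀ n * UnitAddTorus.mFourier n x := rfl
    rw [h0, norm_mul, norm_mul, norm_mFourier_apply, mul_one, Complex.norm_real, Real.norm_eq_abs]
    refine pow_le_pow_left₀ (by positivity) ?_ 2
    exact mul_le_of_le_one_left (norm_nonneg _) (abs_cosSymbol_le t n)
  have hα1 : ∀ n, ‖α 1 n‖ ^ 2 ≤ 4 * ((bracket n)⁻¹ * ‖u₁ n‖) ^ 2 := fun n => by
    have h0 : α 1 n = sinSymbol t n * u₁ n * UnitAddTorus.mFourier n x := rfl
    rw [h0, norm_mul, norm_mul, norm_mFourier_apply, mul_one, Complex.norm_real, Real.norm_eq_abs]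
    have h1 := abs_sinSymbol_le t n
    rw [max_eq_left (by rw [abs_of_nonneg ht.1]; linarith [ht.2])] at h1
    calc _ ≤ (2 * (bracket n)⁻¹ * ‖u₁ n‖) ^ 2 := by gcongr
      _ = _ := by ring
  have hQ : ∑ n ∈ freqBox m, ∑ j, ‖α j n‖ ^ 2 ≤
      ∑' n, (‖u₀ n‖ ^ 2 + 4 * ((bracket n)⁻¹ * ‖u₁ n‖) ^ 2) := by
    refine le_trans (Finset.sum_le_sum fun n _ => ?_)
      ((hs₀.add hs₁).sum_le_tsum (freqBox m) fun n _ => by positivity)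
    rw [Fin.sum_univ_two]
    exact add_le_add (hα0 n) (hα1 n)
  have h1 := hg.eLpNorm_sum_le hv (freqBox m) α hQ
  have h2 := eLpNorm_nnreal_pow_eq_lintegral
    (f := fun ω => ∑ n ∈ freqBox m, ∑ j, α j n * g j n ω) (μ := P) (p := 6) (by norm_num)
  simp only [NNReal.coe_ofNat, ENNReal.rpow_ofNat] at h2
  simp_rw [hsum]
  refine h2.symm.trans_le ?_
  gcongr
  exact h1

/-- The random linear evolution almost surely belongs to `L⁶([0,1] × 𝕋³)`. -/
lemma IsRandomizer.ae_lintegral_waveEnvelope_lt_top [IsProbabilityMeasure P]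
    (hg : IsRandomizer P g) {u₀ u₁ : Freq → ℂ} (hu₀ : u₀ ∈ Sobolev 0) (hu₁ : u₁ ∈ Sobolev (-1)) :
    ∀ᵐ ω ∂P, ∫⁻ t in Icc 0 1,
      waveEnvelope (randomize (g 0) u₀ ω) (randomize (g 1) u₁ ω) t < ∞ := by
  obtain ⟨D, hD⟩ := hg.exists_lintegral_wavePartialSum_le hu₀ hu₁
  have hm := hg.measurable_waveEnvelope u₀ u₁
  refine ae_lt_top (Measurable.lintegral_prod_right' hm) (ne_of_lt ?_)
  rw [← lintegral_prod _ hm.aemeasurable]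
  refine (lintegral_liminf_le (hg.measurable_lintegral_wavePartialSum u₀ u₁)).trans_lt ?_
  refine lt_of_le_of_lt (b := ENNReal.ofReal D ^ 6) ?_ (by finiteness)
  refine liminf_le_of_le (by isBoundedDefault) fun b hb => ?_
  obtain ⟨m, hbm⟩ := hb.exists
  refine hbm.trans ?_
  rw [lintegral_prod_symm _ (hg.measurable_lintegral_wavePartialSum u₀ u₁ m).aemeasurable]
  have hbound : ∀ t ∈ Icc (0 : ℝ) 1, ∫⁻ ω, ∫⁻ x, ‖wavePartialSum (randomize (g 0) u₀ ω)
      (randomize (g 1) u₁ ω) m t x‖ₑ ^ 6 ∂torusMeasure ∂P ≤ ENNReal.ofReal D ^ 6 := by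
    intro t ht
    rw [lintegral_lintegral_swap]
    · refine (lintegral_mono fun x => hD m t ht x).trans_eq ?_
      rw [lintegral_const, measure_univ, mul_one]
    · have h1 := ((hg.measurable_wavePartialSum u₀ u₁ m).enorm.pow_const 6).comp
        (f := fun p : Ω × T3 => ((p.1, t), p.2)) (by fun_prop)
      exact h1.aemeasurable
  refine (setLIntegral_mono' measurableSet_Icc hbound).trans_eq ?_
  rw [setLIntegral_const, Real.volume_Icc]
  simp

end RandomWave

end CubicNLW

end

open CubicNLW

theorem theorem1 {Ω : Type*} [MeasurableSpace Ω] (P : Measure Ω) [IsProbabilityMeasure P]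
    (s : ℝ) (hs : 0 ≤ s) (u₀ u₁ : Freq → ℂ)
    (hu₀ : u₀ ∈ Sobolev s) (hu₁ : u₁ ∈ Sobolev (s - 1))
    (g : Fin 2 → Freq → Ω → ℂ) (hg : IsRandomizer P g) :
    ∃ T : Ω → ℝ, Measurable T ∧ ∀ᵐ ω ∂P,
      0 < T ω ∧
      randomize (g 0) u₀ ω ∈ Sobolev s ∧
      randomize (g 1) u₁ ω ∈ Sobolev (s - 1) ∧
      solutionClass (randomize (g 0) u₀ ω) (randomize (g 1) u₁ ω) (T ω)
        ⊆ {u | ContinuousOn u (Icc 0 (T ω))} ∧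
      ∃ u ∈ solutionClass
          (randomize (g 0) u₀ ω) (randomize (g 1) u₁ ω) (T ω),
        IsSolution
          (randomize (g 0) u₀ ω) (randomize (g 1) u₁ ω) (T ω) u ∧
        (∀ w ∈ solutionClass
            (randomize (g 0) u₀ ω) (randomize (g 1) u₁ ω) (T ω),
          IsSolution
            (randomize (g 0) u₀ ω) (randomize (g 1) u₁ ω) (T ω) w →
          EqOn w u (Icc 0 (T ω))) ∧
        (IsRealDist u₀ → IsRealDist u₁ →
          ∀ t ∈ Icc 0 (T ω), IsRealFun (u t)) := by
  have h01 : Sobolev s ⊆ Sobolev 0 := sobolev_mono hs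
  have h11 : Sobolev (s - 1) ⊆ Sobolev (-1) := sobolev_mono (by linarith)
  have hm := hg.measurable_waveEnvelope u₀ u₁
  refine ⟨fun ω => lifespan (∫⁻ t in Icc 0 1,
    waveEnvelope (randomize (g 0) u₀ ω) (randomize (g 1) u₁ ω) t).toReal,
    measurable_lifespan.comp (Measurable.lintegral_prod_right' hm).ennreal_toReal, ?_⟩
  filter_upwards [hg.ae_randomize_mem_sobolev hu₀ 0, hg.ae_randomize_mem_sobolev hu₁ 1,
    hg.ae_lintegral_waveEnvelope_lt_top (h01 hu₀) (h11 hu₁),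
    hg.ae_isRealDist 0 (a := u₀), hg.ae_isRealDist 1 (a := u₁)] with ω h₀ h₁ hfin hr₀ hr₁
  have ha := h01 h₀
  have hb := h11 h₁
  have hM : 0 ≤ (∫⁻ t in Icc 0 1,
    waveEnvelope (randomize (g 0) u₀ ω) (randomize (g 1) u₁ ω) t).toReal := ENNReal.toReal_nonneg
  obtain ⟨u, hu, hsol, huniq⟩ := exists_unique_solution ha hb
    (hm.comp measurable_prodMk_left) hM (ENNReal.ofReal_toReal hfin.ne).ge
    fun t _ => normL6_linearWave_le ha hb t
  refine ⟨lifespan_pos hM, h₀, h₁, fun w hw => continuousOn_of_mem_solutionClass ha hb hw,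
    u, hu, hsol, huniq, fun hreal₀ hreal₁ t ht => isRealFun_of_conjL2_eq ?_⟩
  -- the conjugate of `u` solves the same equation, so that it equals `u` by uniqueness
  exact huniq _ (conjL2_mem_solutionClass ha hb (hr₀ hreal₀) (hr₁ hreal₁) hu)
    (hsol.conjL2 ha hb (hr₀ hreal₀) (hr₁ hreal₁) (lifespan_le_one hM)) ht
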